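/- Let $n\ge 2$, $R>0$, $0<L<R/n$, $\lambda>L$, $v_{\max}>0$, $v^*\in(0,v_{\max})$, $\mu>0$. Let $V\in C^3((L,+\infty);[0,+\infty))$ satisfy $\lim_{x\to L^+}V(x)=+\infty$, $V(x)=0$ for $x\ge\lambda$, and $V'(x)<0$, $V''(x)>0$ for $x\in(L,\lambda)$. Let $b:\mathbb R\to(v^*-v_{\max},v^*)$ be a nondecreasing $C^2$ function with $b(0)=0$, $xb(x)>0$ for $x\ne0$, and $b'(0)>0$. Let $$\Omega=\Big\{(s_2,\dots,s_n,v_1,\dots,v_n)\in\mathbb R^{2n-1}:\ s_i>L\ (i=2,\dots,n),\ L+\sum_{i=2}^n s_i<R,\ 0<v_i<v_{\max}\ (i=1,\dots,n)\Big\},$$ and put $s_1=s_{n+1}=R-\sum_{i=2}^n s_i$, $v_0=v_n$, $v_{n+1}=v_1$. For $i=1,\dots,n$ let $f_i(s)=v^*-b(V'(s_{i+1})-V'(s_i))$, $$Z_i(s,v)=-v_{\max}^2\,b'(V'(s_{i+1})-V'(s_i))\big(V''(s_{i+1})(v_i-v_{i+1})-V''(s_i)(v_{i-1}-v_i)\big),$$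 $$F_i=\frac1{\beta(v_i,f_i(s))}\left(\frac{Z_i(s,v)-\mu v_{\max}^2(v_i-f_i(s))}{v_i(v_{\max}-v_i)}+V'(s_i)-V'(s_{i+1})\right),\qquad \beta(v,y)=\frac{v_{\max}^3(v+y)-2v_{\max}^2yv}{2(v_{\max}-v)^2v^2},$$ and consider on $\Omega$ the closed-loop system $$\dot s_i=v_{i-1}-v_i\ (i=2,\dots,n),\qquad \dot v_i=F_i\ (i=1,\dots,n).$$ Let $$H(s,v)=\frac{v_{\max}^2}{2}\sum_{i=1}^n\frac{(v_i-f_i(s))^2}{v_i(v_{\max}-v_i)}+\sum_{i=1}^nV(s_i),\qquad U=H-nV(R/n),$$ $$\mu_n=\min\Big\{\sum_{i=1}^n(x_i-x_{i-1})^2:\ x\in\mathbb R^n,\ x_0=x_n,\ |x|=1,\ \sum_{i=1}^n x_i=0\Big\}.$$ All norms are Euclidean. Class $K$ is the class of continuous strictly increasing $a:[0,\infty)\to[0,\infty)$ with $a(0)=0$, and $K_\infty$ is the class of unbounded ones; $KL$ is the class of continuous $\sigma:[0,\infty)^2\to[0,\infty)$ such that $\sigma(\cdot,t)$ is of class $K$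 for each $t$, and $\sigma(r,\cdot)$ is nonincreasing with limit $0$ for each $r$. A size function on $\Omega$ is a continuous $\varphi:\Omega\to[0,\infty)$ such that $\{x\in\Omega:\varphi(x)\le r\}$ is compact for every $r>\inf\varphi(\Omega)$. **Theorem 3.** Suppose that $R<n\lambda$ and let $x^*=(\tfrac Rn1_{n-1},v^*1_n)$. Then: 1. $x^*$ is the unique equilibrium of the closed-loop system in $\Omega$. 2. For every initial condition in $\Omega$ there is a unique solution in $\Omega$, and it is defined for all $t\ge0$ (every solution in $\Omega$ on a time interval starting at $0$ is a restriction of it). 3. $x^*$ is uniformly globally asymptotically stable, i.e. there are $\sigma_0\in KL$ and a size function $\varphi$ on $\Omega$ with $\varphi(x^*)=0$ such that every solution $x(t)=(s(t),v(t))$ satisfies $|x(t)-x^*|\le\sigma_0(\varphi(x(0)),t)$ for all $t\ge0$. 4. There are $\sigma\in KL$ and $a\in K_\infty$ such that every solution satisfies, for all $t\ge0$, $$a\big(|x(t)-x^*|\big)\le U(x(t))\le\sigma\big(U(x(0)),t\big).$$ 5. For every $\vartheta\in(0,1)$ the constant $\bar\omega=\min\big(\mu,\ \vartheta^2b'(0)V''(R/n)\mu_n\big)$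 is positive, and there is a size function $\kappa:\Omega\to[0,\infty)$ with $\kappa(x^*)=0$ such that every solution satisfies $|x(t)-x^*|\le e^{-\bar\omega t}\kappa(x(0))$ for all $t\ge0$. -/

import Mathlib

open Set Filter Topology

/-- Class `K`: continuous, strictly increasing functions on `[0, ∞)` vanishing at `0`
(values at negative arguments are irrelevant). -/
def IsClassK (a : ℝ → ℝ) : Prop :=
  ContinuousOn a (Ici 0) ∧ StrictMonoOn a (Ici 0) ∧ a 0 = 0

/-- Class `K_∞`: unbounded functions of class `K`. -/
def IsClassKInfty (a : ℝ → ℝ) : Prop :=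
  IsClassK a ∧ Tendsto a atTop atTop

/-- Class `KL`: jointly continuous `σ` on `[0, ∞) × [0, ∞)`, of class `K` in the first argument,
non-increasing with limit `0` in the second argument. -/
def IsClassKL (σ : ℝ → ℝ → ℝ) : Prop :=
  ContinuousOn (Function.uncurry σ) (Ici 0 ×ˢ Ici 0) ∧
  (∀ t, 0 ≤ t → IsClassK (fun r => σ r t)) ∧
  (∀ r, 0 ≤ r → AntitoneOn (σ r) (Ici 0) ∧ Tendsto (σ r) atTop (𝓝 0))

section DynamicalSystems

/-- `x` is a solution of `x' = f x` on the time interval `J`, with values in the state space `D`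
(one-sided derivatives at endpoints belonging to `J`). -/
def IsSolution {E : Type*} [NormedAddCommGroup E] [NormedSpace ℝ E]
    (f : E → E) (D : Set E) (J : Set ℝ) (x : ℝ → E) : Prop :=
  ∀ t ∈ J, x t ∈ D ∧ HasDerivWithinAt x (f (x t)) J t

/-- Through every point of `D` there is a solution which is defined for all `t ≥ 0` and stays in
`D`, and every solution with the same initial value, on any time interval starting at `0`, is a
restriction of it. -/
def IsForwardComplete {E : Type*} [NormedAddCommGroup E] [NormedSpace ℝ E]
    (f : E → E) (D : Set E) : Prop :=
  ∀ x₀ ∈ D, ∃ x : ℝ → E, IsSolution f D (Ici 0) x ∧ x 0 = x₀ ∧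
    ∀ (J : Set ℝ) (y : ℝ → E), J.OrdConnected → (0 : ℝ) ∈ J → J ⊆ Ici 0 →
      IsSolution f D J y → y 0 = x₀ → EqOn y x J

/-- Size functions on `D`: non-negative continuous functions on `D` whose sublevel sets in `D`
are compact, for every level above the infimum. -/
def IsSizeFunction {E : Type*} [TopologicalSpace E] (D : Set E) (φ : E → ℝ) : Prop :=
  ContinuousOn φ D ∧ (∀ x ∈ D, 0 ≤ φ x) ∧
  ∀ r, sInf (φ '' D) < r → IsCompact {x | x ∈ D ∧ φ x ≤ r}

/-- Uniform global asymptotic stability of the equilibrium `xe` of `x' = f x` on `D`. -/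
def IsUniformlyGloballyAsymptoticallyStable {E : Type*} [NormedAddCommGroup E] [NormedSpace ℝ E]
    (f : E → E) (D : Set E) (xe : E) : Prop :=
  xe ∈ D ∧ f xe = 0 ∧ IsForwardComplete f D ∧
  ∃ (σ : ℝ → ℝ → ℝ) (φ : E → ℝ), IsClassKL σ ∧ IsSizeFunction D φ ∧ φ xe = 0 ∧
    ∀ x : ℝ → E, IsSolution f D (Ici 0) x → ∀ t, 0 ≤ t → ‖x t - xe‖ ≤ σ (φ (x 0)) t

end DynamicalSystems

/-- The constants and functions that enter the model: road length `R`, safety distance `L`,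
interaction distance `lam`, speed limit `vmax`, desired speed `vstar`, gain `mu`,
potential `V` and the function `b`. No property is imposed here. -/
structure RingRoad where
  R : ℝ
  L : ℝ
  lam : ℝ
  vmax : ℝ
  vstar : ℝ
  mu : ℝ
  V : ℝ → ℝ
  b : ℝ → ℝ

namespace RingRoad

/-- The space `ℝ^(2n-1)` of `(s₂, …, sₙ, v₁, …, vₙ)` with its Euclidean norm. Vehicle `k + 1` has
index `k : Fin n`, so that `s₂, …, sₙ` are indexed by the non-zero elements of `Fin n`. Indices
are cyclic: `i + 1` and `i - 1` are taken modulo `n`. -/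
abbrev State (n : ℕ) [NeZero n] : Type :=
  EuclideanSpace ℝ ({i : Fin n // i ≠ 0} ⊕ Fin n)

noncomputable section

variable (P : RingRoad) {n : ℕ} [NeZero n]

/-- The spacings `s₁, …, sₙ`, where `s₁ = R - (s₂ + ⋯ + sₙ)`. -/
def gap (x : State n) (i : Fin n) : ℝ :=
  if h : i = 0 then P.R - ∑ j : {i : Fin n // i ≠ 0}, x (Sum.inl j) else x (Sum.inl ⟨i, h⟩)

/-- The speeds `v₁, …, vₙ`. -/
def speed (x : State n) (i : Fin n) : ℝ := x (Sum.inr i)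

/-- The state space `Ω`. -/
def stateSpace (n : ℕ) [NeZero n] : Set (State n) :=
  {x | (∀ j : {i : Fin n // i ≠ 0}, P.L < x (Sum.inl j)) ∧
    P.L + ∑ j : {i : Fin n // i ≠ 0}, x (Sum.inl j) < P.R ∧
    ∀ i : Fin n, 0 < speed x i ∧ speed x i < P.vmax}

/-- `V'(s_{i+1}) - V'(s_i)`. -/
def forceDiff (x : State n) (i : Fin n) : ℝ :=
  deriv P.V (P.gap x (i + 1)) - deriv P.V (P.gap x i)

/-- The spacing-dependent desired speed `f_i(s)`. -/
def desiredSpeed (x : State n) (i : Fin n) : ℝ := P.vstar - P.b (P.forceDiff x i)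

/-- The function `β(v, y)`. -/
def beta (v y : ℝ) : ℝ :=
  (P.vmax ^ 3 * (v + y) - 2 * P.vmax ^ 2 * y * v) / (2 * (P.vmax - v) ^ 2 * v ^ 2)

/-- The viscosity term `Z_i(s, v)`. -/
def viscosity (x : State n) (i : Fin n) : ℝ :=
  -P.vmax ^ 2 * deriv P.b (P.forceDiff x i) *
    (deriv (deriv P.V) (P.gap x (i + 1)) * (speed x i - speed x (i + 1)) -
      deriv (deriv P.V) (P.gap x i) * (speed x (i - 1) - speed x i))

/-- The cruise controller `F_i`. -/
def controller (x : State n) (i : Fin n) : ℝ :=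
  1 / P.beta (speed x i) (P.desiredSpeed x i) *
    ((P.viscosity x i - P.mu * P.vmax ^ 2 * (speed x i - P.desiredSpeed x i)) /
        (speed x i * (P.vmax - speed x i)) +
      deriv P.V (P.gap x i) - deriv P.V (P.gap x (i + 1)))

/-- The closed-loop vector field: `s_i' = v_{i-1} - v_i` for `i = 2, …, n` and `v_i' = F_i` for
`i = 1, …, n`. -/
def closedLoop (x : State n) : State n :=
  WithLp.toLp 2 (Sum.elim
    (fun j : {i : Fin n // i ≠ 0} => speed x (j.1 - 1) - speed x j.1)
    (fun i : Fin n => P.controller x i))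

/-- The Lyapunov function `H`. -/
def lyapunovH (x : State n) : ℝ :=
  P.vmax ^ 2 / 2 *
      ∑ i : Fin n, (speed x i - P.desiredSpeed x i) ^ 2 / (speed x i * (P.vmax - speed x i)) +
    ∑ i : Fin n, P.V (P.gap x i)

/-- The function `U = H - n V(R/n)`. -/
def lyapunovU (x : State n) : ℝ := P.lyapunovH x - n * P.V (P.R / n)

/-- The point `(R/n, …, R/n, v*, …, v*)`. -/
def equilibrium (n : ℕ) [NeZero n] : State n :=
  WithLp.toLp 2 (Sum.elim (fun _ => P.R / n) (fun _ => P.vstar))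

/-- The values `∑ (x_i - x_{i-1})²` (cyclic indices) over the unit vectors `x` of `ℝⁿ` whose
entries sum to zero. -/
def cyclicValues (n : ℕ) [NeZero n] : Set ℝ :=
  {q | ∃ x : EuclideanSpace ℝ (Fin n), ‖x‖ = 1 ∧ ∑ i, x i = 0 ∧
    q = ∑ i : Fin n, (x i - x (i - 1)) ^ 2}

/-- The constant `μₙ`, the minimum of the above values. -/
def muN (n : ℕ) [NeZero n] : ℝ := sInf (cyclicValues n)

/-- The convergence rate `min (μ, ϑ² b'(0) V''(R/n) μₙ)`. -/
def rate (n : ℕ) [NeZero n] (θ : ℝ) : ℝ :=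
  min P.mu (θ ^ 2 * deriv P.b 0 * deriv (deriv P.V) (P.R / n) * muN n)

/-- The infimum in the definition of `muN` is a minimum. -/
theorem isLeast_muN (n : ℕ) [NeZero n] (hn : 2 ≤ n) : IsLeast (cyclicValues n) (muN n) := by
  let K : Set (EuclideanSpace ℝ (Fin n)) := {x | ‖x‖ = 1 ∧ ∑ i, x i = 0}
  have himg : cyclicValues n = (fun x : EuclideanSpace ℝ (Fin n) =>
      ∑ i : Fin n, (x i - x (i - 1)) ^ 2) '' K := by
    ext q
    constructor
    · rintro ⟨x, h1, h2, h3⟩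
      exact ⟨x, ⟨h1, h2⟩, h3.symm⟩
    · rintro ⟨x, ⟨h1, h2⟩, h3⟩
      exact ⟨x, h1, h2, h3.symm⟩
  have hK : IsCompact K := by
    have h : K = Metric.sphere 0 1 ∩ {x | ∑ i, x i = 0} := by
      ext x
      simp [K]
    rw [h]
    refine (isCompact_sphere _ _).inter_right (isClosed_eq ?_ continuous_const)
    fun_prop
  have hne : K.Nonempty := by
    have h01 : (⟨0, by omega⟩ : Fin n) ≠ ⟨1, by omega⟩ := by simp
    let w : EuclideanSpace ℝ (Fin n) :=
      EuclideanSpace.single ⟨0, by omega⟩ 1 - EuclideanSpace.single ⟨1, by omega⟩ 1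
    have hw : w ≠ 0 := by
      intro h
      have := congrArg (fun z : EuclideanSpace ℝ (Fin n) => z ⟨0, by omega⟩) h
      simp [w] at this
    have hsum : ∑ i, w i = 0 := by
      simp [w, Finset.sum_sub_distrib, EuclideanSpace.single]
    refine ⟨(‖w‖)⁻¹ • w, ?_, ?_⟩
    · rw [norm_smul, norm_inv, norm_norm, inv_mul_cancel₀ (norm_ne_zero_iff.mpr hw)]
    · simp only [PiLp.smul_apply, smul_eq_mul, ← Finset.mul_sum, hsum, mul_zero]
  rw [muN, himg]
  refine IsCompact.isLeast_sInf (hK.image ?_) (hne.image _)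
  fun_prop

end

end RingRoad

/-! The function U is a strict Lyapunov function. Since the gaps sum to R around the ring, their
deviations from R/n sum to zero. The tangent line of V at R/n may therefore be subtracted from each
V(s_i) without changing the sum, so U is a weighted sum of squares (v_i - f_i)² plus the excesses of
V over that tangent line (`lyapunovU_eq`). The excesses are positive off R/n because R/n < λ.

The weight β and the viscosity Z_i make the derivative of U along the field equal to -W. Here W is a
multiple of the same weighted squares plus the sum of b(d_i) d_i, with d_i = V'(s_{i+1}) - V'(s_i)
(`lyapunovU_deriv`). W vanishes only at the equilibrium: if all d_i are zero, all V'(s_i) coincide,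
and the fixed sum of the gaps makes every gap R/n. Thus no invariance principle is needed, and
uniqueness of the equilibrium follows as well.

Sublevel sets of U are compact in Ω (`isCompact_sublevel`): V blows up at L, and the quotients blow
up at speeds 0 and v_max because f_i stays strictly between these values. This gives forward
completeness. Compactness also bounds uniformly the time needed to pass from one sublevel set to a
smaller one.

Near the equilibrium, linearising b and V' and using the discrete Poincaré inequality with constant
μ_n give W ≥ 2ω̄U (`eventually_rate_mul_le`). With the uniform entrance time, U decays globally like
exp(-2ω̄t), with an overshoot depending only on U(x(0)). Finally |x - x*|² ≤ C U on all of Ω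
(`exists_sq_norm_le`), so the distance decays at rate ω̄. Both KL estimates are read off from these
exponential bounds. -/

section Dynamics

/-! ### Existence, uniqueness and monotone quantities for autonomous equations. -/

variable {E : Type*} [NormedAddCommGroup E] [NormedSpace ℝ E]

/-- Solutions of an equation with Lipschitz right-hand side are unique forward in time. -/
theorem LipschitzOnWith.eqOn_of_hasDerivWithinAt {g : E → E} {K : NNReal} {S : Set E}
    (hg : LipschitzOnWith K g S) {J : Set ℝ} (hJ : J.OrdConnected) (h0 : (0 : ℝ) ∈ J)
    (hJ0 : J ⊆ Ici 0) {x y : ℝ → E}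
    (hx : ∀ t ∈ J, x t ∈ S ∧ HasDerivWithinAt x (g (x t)) J t)
    (hy : ∀ t ∈ J, y t ∈ S ∧ HasDerivWithinAt y (g (y t)) J t) (hxy : x 0 = y 0) :
    EqOn x y J := by
  intro T hT
  have hsub : Icc 0 T ⊆ J := hJ.out h0 hT
  have key : ∀ z : ℝ → E, (∀ t ∈ J, z t ∈ S ∧ HasDerivWithinAt z (g (z t)) J t) →
      ∀ t ∈ Ico 0 T, HasDerivWithinAt z (g (z t)) (Ici t) t := by
    intro z hz t ht
    refine (hz t (hsub ⟨ht.1, ht.2.le⟩)).2.mono_of_mem_nhdsWithin ?_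
    exact mem_of_superset (Icc_mem_nhdsGE ht.2) fun s hs => hsub ⟨ht.1.trans hs.1, hs.2⟩
  have hc : ∀ z : ℝ → E, (∀ t ∈ J, z t ∈ S ∧ HasDerivWithinAt z (g (z t)) J t) →
      ContinuousOn z (Icc 0 T) := fun z hz t ht =>
    ((hz t (hsub ht)).2.continuousWithinAt).mono hsub
  exact ODE_solution_unique_of_mem_Icc_right (v := fun _ => g) (s := fun _ => S)
    (fun _ _ => hg) (hc x hx) (key x hx) (fun t ht => (hx t (hsub ⟨ht.1, ht.2.le⟩)).1)
    (hc y hy) (key y hy) (fun t ht => (hy t (hsub ⟨ht.1, ht.2.le⟩)).1) hxy ⟨hJ0 hT, le_rfl⟩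

/-- A bounded Lipschitz vector field has forward complete solutions. -/
theorem LipschitzWith.exists_forall_hasDerivWithinAt_Ici [CompleteSpace E] {g : E → E}
    {K : NNReal} (hg : LipschitzWith K g) {M : ℝ} (hM : ∀ x, ‖g x‖ ≤ M) (x₀ : E) :
    ∃ y : ℝ → E, y 0 = x₀ ∧ ∀ t ∈ Ici (0 : ℝ), HasDerivWithinAt y (g (y t)) (Ici 0) t := by
  have hM0 : 0 ≤ M := (norm_nonneg _).trans (hM x₀)
  have hex : ∀ N : ℕ, ∃ y : ℝ → E, y 0 = x₀ ∧
      ∀ t ∈ Icc (0 : ℝ) N, HasDerivWithinAt y (g (y t)) (Icc (0 : ℝ) N) t := by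
    intro N
    have hp : IsPicardLindelof (fun _ => g) (⟨0, le_rfl, N.cast_nonneg⟩ : Icc (0 : ℝ) N) x₀
        (M.toNNReal * N) 0 M.toNNReal K := by
      refine IsPicardLindelof.of_time_independent (fun x _ => ?_) hg.lipschitzOnWith ?_
      · rw [Real.coe_toNNReal _ hM0]; exact hM x
      · simp
    exact hp.exists_eq_forall_mem_Icc_hasDerivWithinAt₀
  choose Y hY0 hY using hex
  have hcomp : ∀ N N' : ℕ, N ≤ N' → EqOn (Y N) (Y N') (Icc (0 : ℝ) N) := by
    intro N N' h
    have hN : (N : ℝ) ≤ N' := by exact_mod_cast h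
    refine hg.lipschitzOnWith (s := univ) |>.eqOn_of_hasDerivWithinAt ordConnected_Icc
      ⟨le_rfl, N.cast_nonneg⟩ (fun t ht => ht.1) (fun t ht => ⟨mem_univ _, hY N t ht⟩)
      (fun t ht => ⟨mem_univ _, ?_⟩) (by rw [hY0, hY0])
    exact (hY N' t ⟨ht.1, ht.2.trans hN⟩).mono (Icc_subset_Icc_right hN)
  refine ⟨fun t => Y ⌈t⌉₊ t, by simp [hY0], fun t ht => ?_⟩
  have ht0 : (0 : ℝ) ≤ t := ht
  -- The extra 1 leaves room to the right of t, so that [0, N] is a neighbourhood of t within [0,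
  -- ∞).
  set N := ⌈t⌉₊ + 1 with hN
  have htN : t < N := by
    rw [hN]; push_cast; linarith [Nat.le_ceil t]
  have heq : ∀ s ∈ Icc (0 : ℝ) N, Y ⌈s⌉₊ s = Y N s := fun s hs =>
    hcomp _ _ (Nat.ceil_le.2 hs.2) ⟨hs.1, Nat.le_ceil s⟩
  have hmem : Icc (0 : ℝ) N ∈ 𝓝[Ici 0] t := by
    filter_upwards [self_mem_nhdsWithin, mem_nhdsWithin_of_mem_nhds (Iio_mem_nhds htN)]
      with s hs hs' using ⟨hs, le_of_lt hs'⟩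
  have h1 := (hY N t ⟨ht0, htN.le⟩).mono_of_mem_nhdsWithin hmem
  have h2 : (fun s => Y ⌈s⌉₊ s) =ᶠ[𝓝[Ici 0] t] Y N := by
    filter_upwards [hmem] with s hs using heq s hs
  have h3 := heq t ⟨ht0, htN.le⟩
  change HasDerivWithinAt _ (g (Y ⌈t⌉₊ t)) _ _
  rw [h3]
  exact h1.congr_of_eventuallyEq h2 h3

/-- Smooth cutoff of a compact set inside an open set. -/
theorem IsCompact.exists_contDiff_cutoff [FiniteDimensional ℝ E] {K D : Set E}
    (hK : IsCompact K) (hD : IsOpen D) (hKD : K ⊆ D) :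
    ∃ χ : E → ℝ, ContDiff ℝ 1 χ ∧ HasCompactSupport χ ∧ tsupport χ ⊆ D ∧ EqOn χ 1 K ∧
      ∀ x, 0 ≤ χ x := by
  obtain ⟨K', hK', hKK', hK'D⟩ := exists_compact_between hK hD hKD
  obtain ⟨χ, h0, h1, h2⟩ := exists_contMDiffMap_zero_one_of_isClosed (n := 1)
    (modelWithCornersSelf ℝ E) (isOpen_interior (s := K')).isClosed_compl hK.isClosed
    (disjoint_compl_left_iff_subset.2 hKK')
  have hts : tsupport χ ⊆ K' := by
    refine closure_minimal (fun x hx => ?_) hK'.isClosed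
    by_contra hx'
    exact hx (h0 fun hi => hx' (interior_subset hi))
  exact ⟨χ, χ.contMDiff.contDiff, hK'.of_isClosed_subset isClosed_closure hts,
    hts.trans hK'D, h1, fun x => (h2 x).1⟩

/-- A vector field of class `C¹` on an open set agrees on a given compact subset with a bounded,
globally Lipschitz one that is a nonnegative multiple of it. -/
theorem ContDiffOn.exists_lipschitzWith_cutoff [FiniteDimensional ℝ E] {f : E → E} {K D : Set E}
    (hf : ContDiffOn ℝ 1 f D) (hK : IsCompact K) (hD : IsOpen D) (hKD : K ⊆ D) :
    ∃ (χ : E → ℝ) (C : NNReal) (M : ℝ), LipschitzWith C (fun x => χ x • f x) ∧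
      (∀ x, ‖χ x • f x‖ ≤ M) ∧ EqOn χ 1 K ∧ ∀ x, 0 ≤ χ x := by
  obtain ⟨χ, hχ, hc, hts, h1, h0⟩ := hK.exists_contDiff_cutoff hD hKD
  have hcd : ContDiff ℝ 1 (fun x => χ x • f x) := by
    rw [contDiff_iff_contDiffAt]
    intro x
    by_cases hx : x ∈ D
    · exact hχ.contDiffAt.smul (hf.contDiffAt (hD.mem_nhds hx))
    · have : (fun x => χ x • f x) =ᶠ[𝓝 x] fun _ => 0 := by
        filter_upwards [(isClosed_tsupport χ).isOpen_compl.mem_nhds fun h => hx (hts h)] with y hy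
        rw [image_eq_zero_of_notMem_tsupport hy, zero_smul]
      exact contDiffAt_const.congr_of_eventuallyEq this
  have hcs : HasCompactSupport (fun x => χ x • f x) := hc.smul_right
  obtain ⟨C, hC⟩ := hcd.lipschitzWith_of_hasCompactSupport hcs one_ne_zero
  obtain ⟨M, hM⟩ := hcs.exists_bound_of_continuous hcd.continuous
  exact ⟨χ, C, M, hC, hM, h1, h0⟩

variable {f : E → E} {D : Set E} {U W : E → ℝ}

/-- Derivative of a function along a multiple of a vector field. -/
theorem hasDerivWithinAt_lyapunov (hU : ∀ x ∈ D, DifferentiableAt ℝ U x ∧ fderiv ℝ U x (f x) = -W x)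
    {J : Set ℝ} {x : ℝ → E} {t c : ℝ} (hx : x t ∈ D) (h : HasDerivWithinAt x (c • f (x t)) J t) :
    HasDerivWithinAt (fun s => U (x s)) (-(c * W (x t))) J t := by
  have := (hU _ hx).1.hasFDerivAt.comp_hasDerivWithinAt t h
  rwa [map_smul, (hU _ hx).2, smul_eq_mul, mul_neg] at this

theorem IsSolution.hasDerivWithinAt_lyapunov
    (hU : ∀ x ∈ D, DifferentiableAt ℝ U x ∧ fderiv ℝ U x (f x) = -W x)
    {J : Set ℝ} {x : ℝ → E} (hx : IsSolution f D J x) {t : ℝ} (ht : t ∈ J) :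
    HasDerivWithinAt (fun s => U (x s)) (-W (x t)) J t := by
  have := _root_.hasDerivWithinAt_lyapunov hU (c := 1) (hx t ht).1
    (by simpa using (hx t ht).2)
  simpa using this

theorem IsSolution.antitoneOn_lyapunov
    (hU : ∀ x ∈ D, DifferentiableAt ℝ U x ∧ fderiv ℝ U x (f x) = -W x) (hW : ∀ x ∈ D, 0 ≤ W x)
    {J : Set ℝ} (hJ : J.OrdConnected) {x : ℝ → E} (hx : IsSolution f D J x) :
    AntitoneOn (fun s => U (x s)) J := by
  refine antitoneOn_of_hasDerivWithinAt_nonpos hJ.convex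
    (fun t ht => (hx.hasDerivWithinAt_lyapunov hU ht).continuousWithinAt)
    (fun t ht => (hx.hasDerivWithinAt_lyapunov hU (interior_subset ht)).mono interior_subset)
    fun t ht => ?_
  linarith [hW _ (hx t (interior_subset ht)).1]

/-- A `C¹` vector field that admits a function with compact sublevel sets, non-increasing along
the flow, is forward complete. -/
theorem isForwardComplete_of_lyapunov [FiniteDimensional ℝ E] (hD : IsOpen D)
    (hf : ContDiffOn ℝ 1 f D)
    (hU : ∀ x ∈ D, DifferentiableAt ℝ U x ∧ fderiv ℝ U x (f x) = -W x) (hW : ∀ x ∈ D, 0 ≤ W x)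
    (hcomp : ∀ c, IsCompact {x | x ∈ D ∧ U x ≤ c}) : IsForwardComplete f D := by
  intro x₀ hx₀
  set K := {x | x ∈ D ∧ U x ≤ U x₀} with hKdef
  have hK : IsCompact K := hcomp _
  have hKD : K ⊆ D := fun x hx => hx.1
  -- The truncated field χ f has a global flow. As χ ≥ 0, U still does not increase along it while
  -- it stays in D, so its trajectory never leaves K; there χ = 1 and the trajectory solves the
  -- original equation.
  obtain ⟨χ, C, M, hLip, hM, h1, h0⟩ := hf.exists_lipschitzWith_cutoff hK hD hKD
  obtain ⟨y, hy0, hy⟩ := hLip.exists_forall_hasDerivWithinAt_Ici hM x₀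
  have hyc : ContinuousOn y (Ici 0) := fun t ht => (hy t ht).continuousWithinAt
  have hyK : ∀ T : ℝ, 0 ≤ T → y T ∈ K := by
    intro T hT
    -- Continuous induction in time: the set of times spent in K is closed, and after each of them
    -- the trajectory remains for a while in the open set D, where U cannot grow.
    have hcl : IsClosed ({t | y t ∈ K} ∩ Icc 0 T) := by
      have := (hyc.mono (t := Icc 0 T) fun t ht => ht.1).preimage_isClosed_of_isClosed
        isClosed_Icc hK.isClosed
      rwa [inter_comm] at this
    refine hcl.Icc_subset_of_forall_mem_nhdsWithin ?_ ?_ (right_mem_Icc.2 hT)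
    · exact ⟨by rw [hy0]; exact hx₀, by rw [hy0]⟩
    · rintro t ⟨htK, ht⟩
      have hyt : ContinuousWithinAt y (Ici t) t :=
        (hyc t ht.1).mono (Ici_subset_Ici.2 ht.1)
      obtain ⟨u, hu, hsub⟩ := mem_nhdsGE_iff_exists_Ico_subset.1
        (hyt.preimage_mem_nhdsWithin (hD.mem_nhds htK.1))
      have hder : ∀ s ∈ Ico t u, HasDerivWithinAt (fun s => U (y s))
          (-(χ (y s) * W (y s))) (Ico t u) s := fun s hs =>
        _root_.hasDerivWithinAt_lyapunov hU (hsub hs) ((hy s (ht.1.trans hs.1)).mono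
          fun r hr => ht.1.trans hr.1)
      have hanti : AntitoneOn (fun s => U (y s)) (Ico t u) := by
        refine antitoneOn_of_hasDerivWithinAt_nonpos (convex_Ico _ _)
          (fun s hs => (hder s hs).continuousWithinAt)
          (fun s hs => (hder s (interior_subset hs)).mono interior_subset) fun s hs => ?_
        have := mul_nonneg (h0 (y s)) (hW _ (hsub (interior_subset hs)))
        linarith
      refine mem_of_superset (Ioo_mem_nhdsGT hu) fun s hs => ⟨hsub ⟨hs.1.le, hs.2⟩, ?_⟩
      exact (hanti ⟨le_rfl, hu⟩ ⟨hs.1.le, hs.2⟩ hs.1.le).trans htK.2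
  refine ⟨y, fun t ht => ⟨(hyK t ht).1, ?_⟩, hy0, fun J z hJ h0J hJ0 hz hz0 => ?_⟩
  · have := hy t ht
    rwa [h1 (hyK t ht), Pi.one_apply, one_smul] at this
  -- A competing solution is also confined to K by the monotonicity of U, so it solves the truncated
  -- Lipschitz equation and coincides with y.
  · have hzK : ∀ t ∈ J, z t ∈ K := fun t ht =>
      ⟨(hz t ht).1, (hz.antitoneOn_lyapunov hU hW hJ h0J ht (hJ0 ht)).trans (by simp only [hz0, le_refl])⟩
    refine (hLip.lipschitzOnWith (s := univ)).eqOn_of_hasDerivWithinAt hJ h0J hJ0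
      (fun t ht => ⟨mem_univ _, ?_⟩) (fun t ht => ⟨mem_univ _, (hy t (hJ0 ht)).mono hJ0⟩)
      (by rw [hz0, hy0])
    rw [h1 (hzK t ht), Pi.one_apply, one_smul]
    exact (hz t ht).2

/-- Exponential decay of a Lyapunov function from the time `T` on. -/
theorem IsSolution.lyapunov_le_exp
    (hU : ∀ x ∈ D, DifferentiableAt ℝ U x ∧ fderiv ℝ U x (f x) = -W x)
    {x : ℝ → E} (hx : IsSolution f D (Ici 0) x) {T ω : ℝ} (hT : 0 ≤ T)
    (hω : ∀ t, T ≤ t → ω * U (x t) ≤ W (x t)) {t : ℝ} (ht : T ≤ t) :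
    U (x t) ≤ U (x T) * Real.exp (-ω * (t - T)) := by
  have hsub : Ici T ⊆ Ici 0 := Ici_subset_Ici.2 hT
  have hder : ∀ s ∈ Ici T, HasDerivWithinAt (fun s => Real.exp (ω * (s - T)) * U (x s))
      (Real.exp (ω * (s - T)) * ω * U (x s) + Real.exp (ω * (s - T)) * (-W (x s))) (Ici T) s := by
    intro s hs
    refine HasDerivWithinAt.mul ?_ ((hx.hasDerivWithinAt_lyapunov hU (hsub hs)).mono hsub)
    refine HasDerivWithinAt.exp ?_
    simpa using ((hasDerivWithinAt_id s (Ici T)).sub_const T).const_mul ω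
  have hanti : AntitoneOn (fun s => Real.exp (ω * (s - T)) * U (x s)) (Ici T) := by
    refine antitoneOn_of_hasDerivWithinAt_nonpos (convex_Ici _)
      (fun s hs => (hder s hs).continuousWithinAt)
      (fun s hs => (hder s (interior_subset hs)).mono interior_subset) fun s hs => ?_
    have := mul_le_mul_of_nonneg_left (hω s (interior_subset hs)) (Real.exp_pos (ω * (s - T))).le
    linarith
  have h := hanti (self_mem_Ici) (show t ∈ Ici T from ht) ht
  simp only [sub_self, mul_zero, Real.exp_zero, one_mul] at h
  calc U (x t) = Real.exp (-ω * (t - T)) * (Real.exp (ω * (t - T)) * U (x t)) := by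
        rw [← mul_assoc, ← Real.exp_add]; simp
    _ ≤ Real.exp (-ω * (t - T)) * U (x T) := by gcongr
    _ = _ := mul_comm _ _

/-- A monotone function has a continuous monotone majorant. -/
theorem Monotone.exists_continuous_monotone_ge {m : ℝ → ℝ} (hm : Monotone m) :
    ∃ g : ℝ → ℝ, Continuous g ∧ Monotone g ∧ m ≤ g := by
  have hint : ∀ a b, IntervalIntegrable m MeasureTheory.volume a b := fun a b =>
    hm.intervalIntegrable
  have hg : ∀ c, ∫ x in c..(c + 1), m x = ∫ x in (0 : ℝ)..1, m (x + c) := by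
    intro c
    rw [intervalIntegral.integral_comp_add_right]
    simp [add_comm]
  -- The average of m over [c, c + 1] is at least m c by monotonicity, and it is continuous as a
  -- difference of primitives.
  refine ⟨fun c => ∫ x in c..(c + 1), m x, ?_, fun c c' h => ?_, fun c => ?_⟩
  · have hP := intervalIntegral.continuous_primitive hint 0
    have : (fun c => ∫ x in c..(c + 1), m x) =
        fun c => (∫ x in (0 : ℝ)..(c + 1), m x) - ∫ x in (0 : ℝ)..c, m x := by
      funext c
      rw [intervalIntegral.integral_interval_sub_left (hint _ _) (hint _ _)]
    rw [this]
    exact (hP.comp (continuous_add_const 1)).sub hP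
  · simp only [hg]
    refine intervalIntegral.integral_mono_on zero_le_one ?_ ?_ fun x _ => hm (by linarith)
    · exact (hm.comp (monotone_id.add_const c)).intervalIntegrable
    · exact (hm.comp (monotone_id.add_const c')).intervalIntegrable
  · simp only [hg]
    have : ∫ x in (0 : ℝ)..1, m c ≤ ∫ x in (0 : ℝ)..1, m (x + c) := by
      refine intervalIntegral.integral_mono_on zero_le_one (by simp) ?_
        fun x hx => hm (by linarith [hx.1])
      exact (hm.comp (monotone_id.add_const c)).intervalIntegrable
    simpa using this

/-! ### Uniform entrance times, exponential decay, and size functions. -/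

variable {xe : E}

/-- Solutions starting in a sublevel set reach a smaller one in uniform time. -/
theorem exists_uniform_reaching_time
    (hU : ∀ x ∈ D, DifferentiableAt ℝ U x ∧ fderiv ℝ U x (f x) = -W x)
    (hcomp : ∀ c, IsCompact {x | x ∈ D ∧ U x ≤ c}) (hWc : ContinuousOn W D)
    (hW : ∀ x ∈ D, 0 ≤ W x) (hWpos : ∀ x ∈ D, x ≠ xe → 0 < W x) (hUe : U xe = 0)
    {r : ℝ} (hr : 0 < r) (c : ℝ) :
    ∃ T, 0 ≤ T ∧ ∀ x : ℝ → E, IsSolution f D (Ici 0) x → U (x 0) ≤ c → U (x T) ≤ r := by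
  set A := {x | x ∈ D ∧ U x ≤ c} ∩ {x | r ≤ U x} with hA
  have hUc : ContinuousOn U D := fun x hx => (hU x hx).1.continuousAt.continuousWithinAt
  -- On the compact shell r ≤ U ≤ c, which misses `xe`, W has a positive lower bound m.
  have hAc : IsCompact A := by
    have := (hUc.mono (s := D) (t := {x | x ∈ D ∧ U x ≤ c}) fun x hx => hx.1)
      |>.preimage_isClosed_of_isClosed (hcomp c).isClosed (isClosed_Ici (a := r))
    exact (hcomp c).of_isClosed_subset this inter_subset_left
  have hm : ∃ m, 0 < m ∧ ∀ x ∈ A, m ≤ W x := by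
    rcases A.eq_empty_or_nonempty with h | h
    · exact ⟨1, one_pos, by simp [h]⟩
    · obtain ⟨z, hz, hmin⟩ := hAc.exists_isMinOn h (hWc.mono fun x hx => hx.1.1)
      refine ⟨W z, hWpos z hz.1.1 ?_, fun x hx => hmin hx⟩
      rintro rfl
      exact absurd hz.2 (by simp [hUe, hr])
  obtain ⟨m, hm, hmW⟩ := hm
  -- If U were still above r at time |c| / m, the orbit would have stayed in the shell and U would
  -- have dropped by at least |c|, to a value at most 0.
  refine ⟨|c| / m, by positivity, fun x hx hxc => ?_⟩
  set T := |c| / m with hT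
  have hT0 : 0 ≤ T := by positivity
  by_contra! hlt
  have hanti := hx.antitoneOn_lyapunov hU hW ordConnected_Ici
  have hsub : Icc 0 T ⊆ Ici 0 := fun t ht => ht.1
  have hder : ∀ s ∈ Icc 0 T, HasDerivWithinAt (fun s => U (x s) + m * s)
      (-W (x s) + m) (Icc 0 T) s := by
    intro s hs
    refine ((hx.hasDerivWithinAt_lyapunov hU (hsub hs)).mono hsub).add ?_
    simpa using (hasDerivWithinAt_id s (Icc 0 T)).const_mul m
  have hanti2 : AntitoneOn (fun s => U (x s) + m * s) (Icc 0 T) := by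
    refine antitoneOn_of_hasDerivWithinAt_nonpos (convex_Icc _ _)
      (fun s hs => (hder s hs).continuousWithinAt)
      (fun s hs => (hder s (interior_subset hs)).mono interior_subset) fun s hs => ?_
    have hs' : s ∈ Icc 0 T := interior_subset hs
    have h1 : U (x s) ≤ U (x 0) := hanti (self_mem_Ici) hs'.1 hs'.1
    have h2 : U (x T) ≤ U (x s) := hanti hs'.1 hT0 hs'.2
    have := hmW (x s) ⟨⟨(hx s hs'.1).1, h1.trans hxc⟩, hlt.le.trans h2⟩
    linarith
  have := hanti2 (left_mem_Icc.2 hT0) (right_mem_Icc.2 hT0) hT0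
  simp only [mul_zero, add_zero] at this
  have hmT : m * T = |c| := by rw [hT]; field_simp
  linarith [le_abs_self c]

/-- If the decay inequality `ω U ≤ W` holds on a sublevel set, then `U` decays globally at the
exponential rate `ω`. -/
theorem exists_classKInfty_exp_decay
    (hU : ∀ x ∈ D, DifferentiableAt ℝ U x ∧ fderiv ℝ U x (f x) = -W x)
    (hcomp : ∀ c, IsCompact {x | x ∈ D ∧ U x ≤ c}) (hWc : ContinuousOn W D)
    (hW : ∀ x ∈ D, 0 ≤ W x) (hWpos : ∀ x ∈ D, x ≠ xe → 0 < W x) (hUe : U xe = 0)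
    (hU0 : ∀ x ∈ D, 0 ≤ U x) {ω r : ℝ} (hω : 0 < ω) (hr : 0 < r)
    (hdecay : ∀ x ∈ D, U x ≤ r → ω * U x ≤ W x) :
    ∃ G : ℝ → ℝ, IsClassKInfty G ∧ (∀ c, 0 ≤ c → c ≤ G c) ∧
      ∀ x : ℝ → E, IsSolution f D (Ici 0) x → ∀ t, 0 ≤ t →
        U (x t) ≤ Real.exp (-ω * t) * G (U (x 0)) := by
  have hex : ∀ k : ℕ, ∃ M : ℝ, 1 ≤ M ∧ ∀ x : ℝ → E, IsSolution f D (Ici 0) x → U (x 0) ≤ k →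
      ∀ t, 0 ≤ t → U (x t) ≤ Real.exp (-ω * t) * (U (x 0) * M) := by
    intro k
    obtain ⟨T, hT0, hT⟩ := exists_uniform_reaching_time hU hcomp hWc hW hWpos hUe hr k
    -- The factor exp(ωT) pays for the waiting time: before T only U ≤ U(x 0) is used, after T the
    -- decay inequality applies.
    refine ⟨Real.exp (ω * T), Real.one_le_exp (by positivity), fun x hx hxk t ht => ?_⟩
    have hanti := hx.antitoneOn_lyapunov hU hW ordConnected_Ici
    have h0 := hU0 _ (hx 0 self_mem_Ici).1
    have hexp : Real.exp (-ω * t) * (U (x 0) * Real.exp (ω * T)) =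
        U (x 0) * Real.exp (-ω * (t - T)) := by
      rw [mul_left_comm, ← Real.exp_add]; ring_nf
    rw [hexp]
    rcases le_total T t with h | h
    · refine (hx.lyapunov_le_exp hU hT0 (fun s hs => hdecay _ (hx s (hT0.trans hs)).1 ?_) h).trans ?_
      · exact (hanti hT0 (hT0.trans hs) hs).trans (hT x hx hxk)
      · gcongr
        exact hanti self_mem_Ici hT0 hT0
    · refine (hanti self_mem_Ici ht ht).trans (le_mul_of_one_le_right h0 (Real.one_le_exp ?_))
      nlinarith
  choose M hM1 hM using hex
  -- The factors are known at integer levels only and need not be monotone in the level; summing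
  -- them up to ⌈c⌉ gives a monotone majorant, which is then made continuous.
  have hmono : Monotone fun c : ℝ => ∑ k ∈ Finset.range (⌈c⌉₊ + 1), M k := by
    intro c c' h
    refine Finset.sum_le_sum_of_subset_of_nonneg ?_ fun k _ _ => zero_le_one.trans (hM1 k)
    exact Finset.range_subset_range.2 (Nat.succ_le_succ (Nat.ceil_mono h))
  obtain ⟨g, hgc, hgm, hg⟩ := hmono.exists_continuous_monotone_ge
  have hMg : ∀ c : ℝ, M ⌈c⌉₊ ≤ g c := fun c =>
    (Finset.single_le_sum (fun k _ => zero_le_one.trans (hM1 k))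
      (Finset.self_mem_range_succ _)).trans (hg c)
  have hg1 : ∀ c, 1 ≤ g c := fun c => (hM1 _).trans (hMg c)
  have hle : ∀ c, 0 ≤ c → c ≤ c * g c := fun c hc => le_mul_of_one_le_right hc (hg1 c)
  -- The factor c makes G vanish at 0; with g monotone and at least 1, it also makes G strictly
  -- increasing and unbounded.
  refine ⟨fun c => c * g c, ⟨⟨(continuous_id.mul hgc).continuousOn, fun c hc c' hc' h => ?_,
    zero_mul _⟩, ?_⟩, hle, fun x hx t ht => ?_⟩
  · calc c * g c < c' * g c := mul_lt_mul_of_pos_right h (zero_lt_one.trans_le (hg1 c))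
      _ ≤ c' * g c' := mul_le_mul_of_nonneg_left (hgm h.le) hc'
  · refine tendsto_atTop_mono' atTop ?_ tendsto_id
    filter_upwards [eventually_ge_atTop 0] with c hc using hle c hc
  · refine (hM _ x hx (Nat.le_ceil _) t ht).trans ?_
    have := hU0 _ (hx 0 self_mem_Ici).1
    exact mul_le_mul_of_nonneg_left (mul_le_mul_of_nonneg_left (hMg _) this) (Real.exp_pos _).le

theorem isClassKL_exp_mul {G : ℝ → ℝ} (hG : IsClassK G) {ω : ℝ} (hω : 0 < ω) :
    IsClassKL fun r t => Real.exp (-ω * t) * G r := by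
  obtain ⟨hc, hm, h0⟩ := hG
  have hexp : Antitone fun t : ℝ => Real.exp (-ω * t) := fun t t' h => by
    apply Real.exp_le_exp.2; nlinarith
  refine ⟨?_, fun t ht => ⟨?_, ?_, ?_⟩, fun r hr => ⟨?_, ?_⟩⟩
  · refine ContinuousOn.mul (by fun_prop) (hc.comp continuousOn_fst fun p hp => hp.1)
  · exact continuousOn_const.mul hc
  · exact fun a ha b hb h => mul_lt_mul_of_pos_left (hm ha hb h) (Real.exp_pos _)
  · simp [h0]
  · have hGr : 0 ≤ G r := h0 ▸ hm.monotoneOn self_mem_Ici hr hr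
    exact fun t _ t' _ h => mul_le_mul_of_nonneg_right (hexp h) hGr
  · have : Tendsto (fun t : ℝ => Real.exp (-ω * t)) atTop (𝓝 0) := by
      refine Real.tendsto_exp_atBot.comp ?_
      exact tendsto_id.const_mul_atTop_of_neg (neg_neg_of_pos hω)
    simpa using this.mul_const (G r)

/-- A continuous nonnegative function that dominates, up to a positive factor, a function with
compact sublevel sets is a size function. -/
theorem isSizeFunction_of_le {E : Type*} [NormedAddCommGroup E] {D : Set E} {U κ : E → ℝ}
    (hcomp : ∀ c, IsCompact {x | x ∈ D ∧ U x ≤ c})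
    (hκ : ContinuousOn κ D) (h0 : ∀ x ∈ D, 0 ≤ κ x) {h : ℝ → ℝ}
    (hle : ∀ x ∈ D, ∀ r, κ x ≤ r → U x ≤ h r) : IsSizeFunction D κ := by
  refine ⟨hκ, h0, fun r _ => ?_⟩
  have hc := hcomp (h r)
  have hcl := (hκ.mono (t := {x | x ∈ D ∧ U x ≤ h r}) fun x hx => hx.1)
    |>.preimage_isClosed_of_isClosed hc.isClosed (isClosed_Iic (a := r))
  have : {x | x ∈ D ∧ κ x ≤ r} = {x | x ∈ D ∧ U x ≤ h r} ∩ κ ⁻¹' Iic r := by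
    ext x
    exact ⟨fun hx => ⟨⟨hx.1, hle x hx.1 r hx.2⟩, hx.2⟩, fun hx => ⟨hx.1.1, hx.2⟩⟩
  rw [this]
  exact hc.of_isClosed_subset hcl inter_subset_left

/-- Exponential convergence with a size function as overshoot. -/
theorem exists_sizeFunction_exp_convergence
    (hU : ∀ x ∈ D, DifferentiableAt ℝ U x ∧ fderiv ℝ U x (f x) = -W x)
    (hcomp : ∀ c, IsCompact {x | x ∈ D ∧ U x ≤ c}) (hUe : U xe = 0)
    {C : ℝ} (hC : 0 < C) (hCU : ∀ x ∈ D, ‖x - xe‖ ^ 2 ≤ C * U x)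
    {ω : ℝ} {G : ℝ → ℝ} (hG : IsClassKInfty G) (hGle : ∀ c, 0 ≤ c → c ≤ G c)
    (hdecay : ∀ x : ℝ → E, IsSolution f D (Ici 0) x → ∀ t, 0 ≤ t →
        U (x t) ≤ Real.exp (-(2 * ω) * t) * G (U (x 0))) :
    ∃ κ : E → ℝ, IsSizeFunction D κ ∧ κ xe = 0 ∧
      ∀ x : ℝ → E, IsSolution f D (Ici 0) x → ∀ t, 0 ≤ t →
        ‖x t - xe‖ ≤ Real.exp (-ω * t) * κ (x 0) := by
  have hU0 : ∀ x ∈ D, 0 ≤ U x := fun x hx =>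
    nonneg_of_mul_nonneg_right ((sq_nonneg _).trans (hCU x hx)) hC
  have hUc : ContinuousOn U D := fun x hx => (hU x hx).1.continuousAt.continuousWithinAt
  -- The square root halves the rate 2ω. The bound c ≤ G c makes this function dominate √(C U),
  -- hence inherit compact sublevel sets from U.
  refine ⟨fun x => √(C * G (U x)), ?_, by simp [hUe, hG.1.2.2], fun x hx t ht => ?_⟩
  · refine isSizeFunction_of_le hcomp (h := fun r => r ^ 2 / C) ?_ (fun _ _ => Real.sqrt_nonneg _)
      fun x hx r hr => ?_
    · exact (continuousOn_const.mul (hG.1.1.comp hUc fun x hx => hU0 x hx)).sqrt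
    · have h1 := (Real.sqrt_le_iff.1 hr).2
      rw [le_div_iff₀ hC]
      nlinarith [hGle _ (hU0 x hx)]
  · refine le_of_sq_le_sq ?_ (by positivity)
    have hG0 : 0 ≤ G (U (x 0)) := by
      have := hU0 _ (hx 0 self_mem_Ici).1
      exact this.trans (hGle _ this)
    have he : Real.exp (-ω * t) ^ 2 = Real.exp (-(2 * ω) * t) := by
      rw [← Real.exp_nat_mul]; congr 1; push_cast; ring
    rw [mul_pow, Real.sq_sqrt (by positivity), he]
    calc ‖x t - xe‖ ^ 2 ≤ C * U (x t) := hCU _ (hx t ht).1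
      _ ≤ C * (Real.exp (-(2 * ω) * t) * G (U (x 0))) := by gcongr; exact hdecay x hx t ht
      _ = _ := by ring

end Dynamics

/-- The state stores every gap but the one with index 0. This identity passes between sums over
stored gaps and sums over the whole ring, and so recovers facts about the missing gap. -/
theorem Fintype.sum_subtype_ne_eq_sub {ι : Type*} [Fintype ι] [DecidableEq ι] (g : ι → ℝ) (a : ι) :
    ∑ j : {i : ι // i ≠ a}, g j = ∑ i, g i - g a := by
  rw [Fintype.sum_eq_add_sum_subtype_ne g a, add_sub_cancel_left]

/-! ### Cyclic sums and the discrete Poincaré inequality. -/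

section Cyclic

variable {n : ℕ} [NeZero n]

theorem Fin.sum_comp_add_one (g : Fin n → ℝ) : ∑ i, g (i + 1) = ∑ i, g i :=
  Equiv.sum_comp (Equiv.addRight (1 : Fin n)) g

theorem Fin.sum_comp_sub_one (g : Fin n → ℝ) : ∑ i, g (i - 1) = ∑ i, g i :=
  Equiv.sum_comp (Equiv.subRight (1 : Fin n)) g

theorem Fin.eq_apply_zero_of_apply_add_one_eq {g : Fin n → ℝ} (h : ∀ i, g (i + 1) = g i)
    (i : Fin n) : g i = g 0 := by
  have key : ∀ k : ℕ, g (Fin.ofNat n k) = g 0 := by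
    intro k
    induction k with
    | zero => rfl
    | succ k ih =>
      rw [← ih, ← h (Fin.ofNat n k)]
      congr 1
      ext
      simp [Fin.ofNat, Fin.val_add]
  simpa using key i

namespace RingRoad

/-- The minimum is attained. A minimiser with value 0 would be constant around the cycle, hence 0
because its entries sum to zero, contradicting unit norm. -/
theorem muN_pos (hn : 2 ≤ n) : 0 < muN n := by
  obtain ⟨x, h1, h2, h3⟩ := (isLeast_muN n hn).1
  rw [h3]
  refine (Finset.sum_nonneg fun i _ => sq_nonneg _).lt_of_ne' fun h0 => ?_
  have h4 := (Finset.sum_eq_zero_iff_of_nonneg fun i _ => sq_nonneg _).1 h0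
  have h5 : ∀ i, x (i + 1) = x i := fun i => by
    have := h4 (i + 1) (Finset.mem_univ _)
    rw [add_sub_cancel_right] at this
    exact sub_eq_zero.1 (pow_eq_zero_iff two_ne_zero |>.1 this)
  have h6 := Fin.eq_apply_zero_of_apply_add_one_eq (g := fun i => x i) h5
  have h7 : x 0 = 0 := by
    rw [Finset.sum_congr rfl fun i _ => h6 i] at h2
    simpa [NeZero.ne n] using h2
  have : x = 0 := by
    ext i
    simpa [h7] using h6 i
  simp [this] at h1

/-- Discrete Poincaré inequality: both sides are homogeneous of degree two, so a nonzero vector can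
be normalised and compared with the minimum. -/
theorem muN_mul_sum_sq_le (hn : 2 ≤ n) {y : Fin n → ℝ} (hy : ∑ i, y i = 0) :
    muN n * ∑ i, y i ^ 2 ≤ ∑ i, (y (i + 1) - y i) ^ 2 := by
  have hshift : ∑ i, (y (i + 1) - y i) ^ 2 = ∑ i, (y i - y (i - 1)) ^ 2 := by
    rw [← Fin.sum_comp_add_one (fun i => (y i - y (i - 1)) ^ 2)]
    simp
  rw [hshift]
  set z : EuclideanSpace ℝ (Fin n) := WithLp.toLp 2 y with hz
  have hzy : ∀ i, z i = y i := fun i => rfl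
  have hnorm : ‖z‖ ^ 2 = ∑ i, y i ^ 2 := by
    rw [EuclideanSpace.real_norm_sq_eq]
  rcases eq_or_ne z 0 with h0 | h0
  · rw [← hnorm, h0]
    simpa using Finset.sum_nonneg fun i _ => sq_nonneg (y i - y (i - 1))
  · have hpos : 0 < ‖z‖ := norm_pos_iff.2 h0
    have hmem : ∑ i, ((‖z‖⁻¹ • z) i - (‖z‖⁻¹ • z) (i - 1)) ^ 2 ∈ cyclicValues n := by
      refine ⟨‖z‖⁻¹ • z, ?_, ?_, rfl⟩
      · rw [norm_smul, norm_inv, norm_norm, inv_mul_cancel₀ hpos.ne']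
      · simp [← Finset.mul_sum, hzy, hy]
    have h := (isLeast_muN n hn).2 hmem
    have h2 : ∑ i, ((‖z‖⁻¹ • z) i - (‖z‖⁻¹ • z) (i - 1)) ^ 2 =
        (‖z‖ ^ 2)⁻¹ * ∑ i, (y i - y (i - 1)) ^ 2 := by
      rw [Finset.mul_sum]
      refine Finset.sum_congr rfl fun i _ => ?_
      simp only [PiLp.smul_apply, smul_eq_mul, hzy]
      ring
    rw [h2, ← div_eq_inv_mul, le_div_iff₀ (by positivity), hnorm] at h
    exact h

end RingRoad

end Cyclic

/-! ### One-variable estimates. -/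

section RealFunctions

/-- Mean value theorem around a point of an interval. -/
theorem exists_hasDerivAt_eq_sub_mul {φ φ' : ℝ → ℝ} {S : Set ℝ} (hS : S.OrdConnected) {a s : ℝ}
    (ha : a ∈ S) (hs : s ∈ S) (hd : ∀ u ∈ S, HasDerivAt φ (φ' u) u) (hsa : s ≠ a) :
    ∃ u ∈ S, u ≠ a ∧ 0 < (u - a) * (s - a) ∧ φ s - φ a = φ' u * (s - a) := by
  rcases hsa.lt_or_gt with h | h
  · have hsub : Icc s a ⊆ S := hS.out hs ha
    obtain ⟨u, hu, he⟩ := exists_hasDerivAt_eq_slope φ φ' h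
      (fun u hu => (hd u (hsub hu)).continuousAt.continuousWithinAt)
      (fun u hu => hd u (hsub (Ioo_subset_Icc_self hu)))
    refine ⟨u, hsub (Ioo_subset_Icc_self hu), hu.2.ne, ?_, ?_⟩
    · exact mul_pos_of_neg_of_neg (sub_neg.2 hu.2) (sub_neg.2 h)
    · rw [he]; have : a - s ≠ 0 := (sub_pos.2 h).ne'
      field_simp; ring
  · have hsub : Icc a s ⊆ S := hS.out ha hs
    obtain ⟨u, hu, he⟩ := exists_hasDerivAt_eq_slope φ φ' h
      (fun u hu => (hd u (hsub hu)).continuousAt.continuousWithinAt)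
      (fun u hu => hd u (hsub (Ioo_subset_Icc_self hu)))
    refine ⟨u, hsub (Ioo_subset_Icc_self hu), hu.1.ne', ?_, ?_⟩
    · exact mul_pos (sub_pos.2 hu.1) (sub_pos.2 h)
    · rw [he]; have : s - a ≠ 0 := (sub_pos.2 h).ne'
      field_simp

/-- The sign condition says that φ falls before a and rises after it. The intermediate point of the
mean value theorem lies on the same side of a as s, which transfers the sign to φ s - φ a. -/
theorem lt_of_hasDerivAt_mul_sub_pos {φ φ' : ℝ → ℝ} {S : Set ℝ} (hS : S.OrdConnected) {a s : ℝ}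
    (ha : a ∈ S) (hs : s ∈ S) (hd : ∀ u ∈ S, HasDerivAt φ (φ' u) u)
    (hpos : ∀ u ∈ S, u ≠ a → 0 < φ' u * (u - a)) (hsa : s ≠ a) : φ a < φ s := by
  obtain ⟨u, hu, hua, h1, h2⟩ := exists_hasDerivAt_eq_sub_mul hS ha hs hd hsa
  have h3 := mul_pos (hpos u hu hua) h1
  have h4 : 0 < (u - a) ^ 2 := by have := sub_ne_zero.2 hua; positivity
  have h5 : 0 < φ' u * (s - a) := by
    refine pos_of_mul_pos_right (a := (u - a) ^ 2) ?_ h4.le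
    linarith
  linarith

theorem le_of_hasDerivAt_mul_sub_nonneg {φ φ' : ℝ → ℝ} {S : Set ℝ} (hS : S.OrdConnected) {a s : ℝ}
    (ha : a ∈ S) (hs : s ∈ S) (hd : ∀ u ∈ S, HasDerivAt φ (φ' u) u)
    (hpos : ∀ u ∈ S, 0 ≤ φ' u * (u - a)) : φ a ≤ φ s := by
  rcases eq_or_ne s a with rfl | hsa
  · exact le_rfl
  obtain ⟨u, hu, hua, h1, h2⟩ := exists_hasDerivAt_eq_sub_mul hS ha hs hd hsa
  have h3 := mul_nonneg (hpos u hu) h1.le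
  have h4 : 0 < (u - a) ^ 2 := by have := sub_ne_zero.2 hua; positivity
  have h5 : 0 ≤ φ' u * (s - a) := by
    refine nonneg_of_mul_nonneg_right (a := (u - a) ^ 2) ?_ h4
    linarith
  linarith

/-- Quadratic bounds of the product of a function and its argument near a simple zero. -/
theorem HasDerivAt.eventually_mul_self_ge {b : ℝ → ℝ} {c k : ℝ} (hb : HasDerivAt b c 0)
    (h0 : b 0 = 0) (hc : 0 < c) (hk : k < 1) :
    ∀ᶠ d in 𝓝 0, k * c * d ^ 2 ≤ b d * d ∧ |b d| ≤ (2 - k) * c * |d| := by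
  have hε : 0 < (1 - k) * c := mul_pos (by linarith) hc
  filter_upwards [(hasDerivAt_iff_isLittleO.1 hb).def hε] with d hd
  simp only [h0, sub_zero, smul_eq_mul, Real.norm_eq_abs] at hd
  constructor
  · have h1 : |(b d - d * c) * d| ≤ (1 - k) * c * d ^ 2 := by
      rw [abs_mul, ← sq_abs d, sq, ← mul_assoc]
      gcongr
    linarith [neg_abs_le ((b d - d * c) * d)]
  · calc |b d| = |(b d - d * c) + d * c| := by ring_nf
      _ ≤ |b d - d * c| + |d * c| := abs_add_le _ _
      _ ≤ (1 - k) * c * |d| + |d| * c := by rw [abs_mul, abs_of_pos hc]; gcongr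
      _ = _ := by ring

/-- Strict differentiability gives a two-point estimate. It is needed because V' is compared at two
neighbouring gaps, neither of which has to be R/n. -/
theorem HasStrictDerivAt.eventually_abs_sub {g : ℝ → ℝ} {a q k : ℝ} (hg : HasStrictDerivAt g q a)
    (hq : 0 < q) (hk : k < 1) :
    ∃ ε > 0, ∀ s t, |s - a| < ε → |t - a| < ε → |g s - g t - q * (s - t)| ≤
      (1 - k) * q * |s - t| := by
  have h := (hasStrictFDerivAt_iff_isLittleO.1 hg.hasStrictFDerivAt).def (mul_pos (sub_pos.2 hk) hq)
  obtain ⟨ε, hε, h⟩ := Metric.eventually_nhds_iff.1 h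
  refine ⟨ε, hε, fun s t hs ht => ?_⟩
  have := h (y := (s, t)) (by
    rw [Prod.dist_eq, max_lt_iff]; exact ⟨hs, ht⟩)
  simpa [mul_comm] using this

end RealFunctions

/-! ### The standing assumptions and the potential near and away from R/n. -/

namespace RingRoad

/-- The standing assumptions on the model. -/
structure IsAdmissible (P : RingRoad) (n : ℕ) : Prop where
  two_le : 2 ≤ n
  R_pos : 0 < P.R
  L_pos : 0 < P.L
  L_lt : P.L < P.R / n
  lt_lam : P.R / n < P.lam
  vmax_pos : 0 < P.vmax
  vstar_pos : 0 < P.vstar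
  vstar_lt : P.vstar < P.vmax
  mu_pos : 0 < P.mu
  contDiffOn_V : ContDiffOn ℝ 3 P.V (Ioi P.L)
  V_nonneg : ∀ x, P.L < x → 0 ≤ P.V x
  tendsto_V : Tendsto P.V (𝓝[>] P.L) atTop
  V_zero : ∀ x, P.lam ≤ x → P.V x = 0
  deriv_V_neg : ∀ x, P.L < x → x < P.lam → deriv P.V x < 0
  deriv_deriv_V_pos : ∀ x, P.L < x → x < P.lam → 0 < deriv (deriv P.V) x
  contDiff_b : ContDiff ℝ 2 P.b
  b_mono : Monotone P.b
  b_range : ∀ x, P.vstar - P.vmax < P.b x ∧ P.b x < P.vstar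
  b_zero : P.b 0 = 0
  b_sign : ∀ x, x ≠ 0 → 0 < x * P.b x
  deriv_b_pos : 0 < deriv P.b 0

noncomputable section

variable {P : RingRoad} {n : ℕ}

/-- The excess of the potential over its tangent line at `R / n`. -/
def excess (P : RingRoad) (n : ℕ) (s : ℝ) : ℝ :=
  P.V s - P.V (P.R / n) - deriv P.V (P.R / n) * (s - P.R / n)

namespace IsAdmissible

theorem contDiffOn_deriv_V (h : P.IsAdmissible n) : ContDiffOn ℝ 2 (deriv P.V) (Ioi P.L) :=
  h.contDiffOn_V.deriv_of_isOpen isOpen_Ioi (by norm_num)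

theorem contDiffOn_deriv_deriv_V (h : P.IsAdmissible n) :
    ContDiffOn ℝ 1 (deriv (deriv P.V)) (Ioi P.L) :=
  h.contDiffOn_deriv_V.deriv_of_isOpen isOpen_Ioi (by norm_num)

theorem contDiff_deriv_b (h : P.IsAdmissible n) : ContDiff ℝ 1 (deriv P.b) :=
  ContDiff.deriv' (n := 1) (by simpa [one_add_one_eq_two] using h.contDiff_b)

theorem hasDerivAt_V (h : P.IsAdmissible n) {s : ℝ} (hs : P.L < s) :
    HasDerivAt P.V (deriv P.V s) s :=
  ((h.contDiffOn_V.contDiffAt (Ioi_mem_nhds hs)).differentiableAt (by norm_num)).hasDerivAt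

theorem hasDerivAt_deriv_V (h : P.IsAdmissible n) {s : ℝ} (hs : P.L < s) :
    HasDerivAt (deriv P.V) (deriv (deriv P.V) s) s :=
  ((h.contDiffOn_deriv_V.contDiffAt (Ioi_mem_nhds hs)).differentiableAt (by norm_num)).hasDerivAt

theorem hasStrictDerivAt_deriv_V (h : P.IsAdmissible n) {s : ℝ} (hs : P.L < s) :
    HasStrictDerivAt (deriv P.V) (deriv (deriv P.V) s) s :=
  (h.contDiffOn_deriv_V.contDiffAt (Ioi_mem_nhds hs)).hasStrictDerivAt (by norm_num)

theorem hasDerivAt_b (h : P.IsAdmissible n) (d : ℝ) : HasDerivAt P.b (deriv P.b d) d :=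
  (h.contDiff_b.differentiable (by norm_num) d).hasDerivAt

theorem deriv_deriv_V_eq_pos (h : P.IsAdmissible n) : 0 < deriv (deriv P.V) (P.R / n) :=
  h.deriv_deriv_V_pos _ h.L_lt h.lt_lam

theorem strictMonoOn_deriv_V (h : P.IsAdmissible n) :
    StrictMonoOn (deriv P.V) (Ioc P.L P.lam) := by
  refine strictMonoOn_of_deriv_pos (convex_Ioc _ _)
    (h.contDiffOn_deriv_V.continuousOn.mono fun s hs => hs.1) fun s hs => ?_
  rw [interior_Ioc] at hs
  exact h.deriv_deriv_V_pos s hs.1 hs.2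

/-- V' increases strictly only up to `lam`. Beyond it V' is 0, which still exceeds V'(R/n) because
R/n < `lam`. -/
theorem deriv_V_sub_mul_pos (h : P.IsAdmissible n) {s : ℝ} (hs : P.L < s) (hne : s ≠ P.R / n) :
    0 < (deriv P.V s - deriv P.V (P.R / n)) * (s - P.R / n) := by
  have hmem : P.R / n ∈ Ioc P.L P.lam := ⟨h.L_lt, h.lt_lam.le⟩
  rcases hne.lt_or_gt with hlt | hlt
  · have := h.strictMonoOn_deriv_V ⟨hs, (hlt.trans h.lt_lam).le⟩ hmem hlt
    exact mul_pos_of_neg_of_neg (sub_neg.2 this) (sub_neg.2 hlt)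
  · refine mul_pos (sub_pos.2 ?_) (sub_pos.2 hlt)
    rcases le_or_gt s P.lam with hl | hl
    · exact h.strictMonoOn_deriv_V hmem ⟨hs, hl⟩ hlt
    · have h0 : deriv P.V s = 0 := by
        have : P.V =ᶠ[𝓝 s] fun _ => 0 := by
          filter_upwards [Ioi_mem_nhds hl] with u hu using h.V_zero u (le_of_lt hu)
        rw [this.deriv_eq, deriv_const]
      rw [h0]
      exact h.deriv_V_neg _ h.L_lt h.lt_lam

theorem hasDerivAt_excess (h : P.IsAdmissible n) {s : ℝ} (hs : P.L < s) :
    HasDerivAt (P.excess n) (deriv P.V s - deriv P.V (P.R / n)) s := by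
  have := ((h.hasDerivAt_V hs).sub_const (P.V (P.R / n))).sub
    (((hasDerivAt_id s).sub_const (P.R / n)).const_mul (deriv P.V (P.R / n)))
  simpa [excess] using! this

theorem excess_pos (h : P.IsAdmissible n) {s : ℝ} (hs : P.L < s) (hne : s ≠ P.R / n) :
    0 < P.excess n s := by
  have := lt_of_hasDerivAt_mul_sub_pos (ordConnected_Ioi (a := P.L)) h.L_lt hs
    (fun u hu => h.hasDerivAt_excess hu) (fun u hu => h.deriv_V_sub_mul_pos hu) hne
  simpa [excess] using this

theorem excess_nonneg (h : P.IsAdmissible n) {s : ℝ} (hs : P.L < s) : 0 ≤ P.excess n s := by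
  rcases eq_or_ne s (P.R / n) with rfl | hne
  · simp [excess]
  · exact (h.excess_pos hs hne).le

/-- Quadratic bounds of the potential near `R / n`. -/
theorem exists_local_bounds (h : P.IsAdmissible n) {k : ℝ} (hk0 : 0 < k) (hk : k < 1) :
    ∃ ε > 0, (∀ s t, |s - P.R / n| < ε → |t - P.R / n| < ε →
      (k * deriv (deriv P.V) (P.R / n)) ^ 2 * (s - t) ^ 2 ≤ (deriv P.V s - deriv P.V t) ^ 2 ∧
      (deriv P.V s - deriv P.V t) ^ 2 ≤ (2 * deriv (deriv P.V) (P.R / n)) ^ 2 * (s - t) ^ 2) ∧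
      ∀ s, |s - P.R / n| < ε →
        k * deriv (deriv P.V) (P.R / n) / 2 * (s - P.R / n) ^ 2 ≤ P.excess n s ∧
        P.excess n s ≤ deriv (deriv P.V) (P.R / n) / (2 * k) * (s - P.R / n) ^ 2 := by
  set q := deriv (deriv P.V) (P.R / n) with hq
  set a := P.R / n with ha
  have hqpos : 0 < q := h.deriv_deriv_V_eq_pos
  obtain ⟨ε₁, hε₁, h1⟩ := (h.hasStrictDerivAt_deriv_V h.L_lt).eventually_abs_sub hqpos hk
  -- The second bound keeps the ball inside (L, ∞), where V is differentiable.
  set ε := min ε₁ (a - P.L) with hε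
  have hεpos : 0 < ε := lt_min hε₁ (sub_pos.2 h.L_lt)
  have hL : ∀ s, |s - a| < ε → P.L < s := fun s hs => by
    have := (abs_lt.1 (hs.trans_le (min_le_right _ _))).1
    linarith
  have h1' : ∀ s t, |s - a| < ε → |t - a| < ε →
      |deriv P.V s - deriv P.V t - q * (s - t)| ≤ (1 - k) * q * |s - t| := fun s t hs ht =>
    h1 s t (hs.trans_le (min_le_left _ _)) (ht.trans_le (min_le_left _ _))
  refine ⟨ε, hεpos, fun s t hs ht => ?_, fun s hs => ?_⟩
  · have h2 := h1' s t hs ht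
    set y := deriv P.V s - deriv P.V t
    set x := s - t
    have hqx : |q * x| = q * |x| := by rw [abs_mul, abs_of_pos hqpos]
    have h3 : k * q * |x| ≤ |y| := by
      have := abs_sub_abs_le_abs_sub (q * x) y
      rw [abs_sub_comm (q * x)] at this
      nlinarith
    have h4 : |y| ≤ 2 * q * |x| := by
      have := abs_sub_abs_le_abs_sub y (q * x)
      have : 0 ≤ k * q * |x| := by positivity
      nlinarith
    constructor
    · rw [← sq_abs x, ← sq_abs y, ← mul_pow]
      gcongr
    · rw [← sq_abs x, ← sq_abs y, ← mul_pow]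
      gcongr
  · have hS : (Metric.ball a ε).OrdConnected := by
      rw [Real.ball_eq_Ioo]; exact ordConnected_Ioo
    have hmem : ∀ u, u ∈ Metric.ball a ε ↔ |u - a| < ε := fun u => by
      rw [Metric.mem_ball, Real.dist_eq]
    have haS : a ∈ Metric.ball a ε := Metric.mem_ball_self hεpos
    have hsq : ∀ (c u : ℝ), HasDerivAt (fun u => c * (u - a) ^ 2) (2 * c * (u - a)) u := by
      intro c u
      have := (((hasDerivAt_id u).sub_const a).pow 2).const_mul c
      refine this.congr_deriv ?_
      simp; ring
    have h5 : ∀ u, |u - a| < ε → |(deriv P.V u - deriv P.V a - q * (u - a)) * (u - a)| ≤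
        (1 - k) * q * (u - a) ^ 2 := fun u hu => by
      rw [abs_mul, ← sq_abs (u - a), sq, ← mul_assoc]
      gcongr
      exact h1' u a hu (by simpa using hεpos)
    have he : P.excess n a = 0 := by simp [excess, ha]
    constructor
    -- The excess and the parabola agree at a, and the derivative of their difference has the sign
    -- of u - a; the upper bound below uses the reversed difference.
    · have := le_of_hasDerivAt_mul_sub_nonneg hS haS ((hmem s).2 hs)
        (fun u hu => (h.hasDerivAt_excess (hL u ((hmem u).1 hu))).sub (hsq (k * q / 2) u))
        fun u hu => by
          have := (abs_le.1 (h5 u ((hmem u).1 hu))).1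
          change 0 ≤ (deriv P.V u - deriv P.V a - _) * _
          linarith
      simp only [Pi.sub_apply, he, sub_self, ne_eq, OfNat.ofNat_ne_zero, not_false_eq_true,
        zero_pow, mul_zero] at this
      linarith
    · have := le_of_hasDerivAt_mul_sub_nonneg hS haS ((hmem s).2 hs)
        (fun u hu => (hsq (q / (2 * k)) u).sub (h.hasDerivAt_excess (hL u ((hmem u).1 hu))))
        fun u hu => by
          have h6 := (abs_le.1 (h5 u ((hmem u).1 hu))).2
          -- This is 2 - k ≤ 1 / k, that is (k - 1)² ≥ 0. The constant q / (2k) is chosen so that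
          -- the total loss of powers of k later comes out as exactly k⁴.
          have h7 : (2 - k) * q ≤ 2 * (q / (2 * k)) := by
            have : 2 * (q / (2 * k)) = q / k := by field_simp
            rw [this, le_div_iff₀ hk0]
            nlinarith [mul_nonneg hqpos.le (sq_nonneg (k - 1))]
          have h8 := mul_le_mul_of_nonneg_right h7 (sq_nonneg (u - a))
          change 0 ≤ (_ - (deriv P.V u - deriv P.V a)) * _
          linarith
      simp only [Pi.sub_apply, he, sub_self, ne_eq, OfNat.ofNat_ne_zero, not_false_eq_true,
        zero_pow, mul_zero] at this
      linarith

theorem mul_b_nonneg (h : P.IsAdmissible n) (d : ℝ) : 0 ≤ P.b d * d := by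
  rcases eq_or_ne d 0 with rfl | hd
  · simp
  · rw [mul_comm]; exact (h.b_sign d hd).le

/-- The numerator is v_max² (v (v_max - y) + y (v_max - v)). Positivity makes the division by β in
the controller genuine. -/
theorem beta_pos (h : P.IsAdmissible n) {v y : ℝ} (hv : 0 < v) (hv' : v < P.vmax) (hy : 0 < y)
    (hy' : y < P.vmax) : 0 < P.beta v y := by
  have h1 := sub_pos.2 hv'
  have h2 := sub_pos.2 hy'
  have h3 := h.vmax_pos
  refine div_pos ?_ (by positivity)
  have : P.vmax ^ 3 * (v + y) - 2 * P.vmax ^ 2 * y * v =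
      P.vmax ^ 2 * (v * (P.vmax - y) + y * (P.vmax - v)) := by ring
  rw [this]
  positivity

end IsAdmissible

end

end RingRoad

/-! ### The closed loop on the ring and its Lyapunov function. -/

namespace RingRoad

noncomputable section

variable {P : RingRoad} {n : ℕ} [NeZero n]

/-- The dissipation rate of `H` along the closed loop. -/
def dissipation (P : RingRoad) (x : State n) : ℝ :=
  P.mu * P.vmax ^ 2 *
      ∑ i : Fin n, (speed x i - P.desiredSpeed x i) ^ 2 / (speed x i * (P.vmax - speed x i)) +
    ∑ i : Fin n, P.b (P.forceDiff x i) * P.forceDiff x i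

theorem sum_gap (P : RingRoad) (x : State n) : ∑ i, P.gap x i = P.R := by
  have h0 : P.gap x 0 = P.R - ∑ j : {i : Fin n // i ≠ 0}, x (Sum.inl j) := by simp [gap]
  have h := Fintype.sum_subtype_ne_eq_sub (P.gap x) 0
  have h1 : ∑ j : {i : Fin n // i ≠ 0}, P.gap x j = ∑ j : {i : Fin n // i ≠ 0}, x (Sum.inl j) :=
    Finset.sum_congr rfl fun j _ => by simp [gap, j.2]
  linarith

theorem gap_inl (P : RingRoad) (x : State n) (j : {i : Fin n // i ≠ 0}) :
    P.gap x j = x (Sum.inl j) := by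
  simp [gap, j.2]

theorem mem_stateSpace_iff {x : State n} :
    x ∈ P.stateSpace n ↔ (∀ i, P.L < P.gap x i) ∧ ∀ i, 0 < speed x i ∧ speed x i < P.vmax := by
  constructor
  · rintro ⟨h1, h2, h3⟩
    refine ⟨fun i => ?_, h3⟩
    by_cases hi : i = 0
    · rw [gap, dif_pos hi]; linarith
    · rw [gap, dif_neg hi]; exact h1 _
  · rintro ⟨h1, h3⟩
    refine ⟨fun j => P.gap_inl x j ▸ h1 j, ?_, h3⟩
    have := h1 0
    rw [gap, dif_pos rfl] at this
    linarith

/-- Only an inequality, since the right side also counts the gap with index 0, which is not a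
coordinate of the state. -/
theorem norm_sub_equilibrium_sq (P : RingRoad) (x : State n) :
    ‖x - P.equilibrium n‖ ^ 2 ≤
      ∑ i, (P.gap x i - P.R / n) ^ 2 + ∑ i, (speed x i - P.vstar) ^ 2 := by
  have h := Fintype.sum_subtype_ne_eq_sub (fun i => (P.gap x i - P.R / n) ^ 2) 0
  have h0 : (0 : ℝ) ≤ (P.gap x 0 - P.R / n) ^ 2 := sq_nonneg _
  have h1 : ‖x - P.equilibrium n‖ ^ 2 = ∑ j : {i : Fin n // i ≠ 0}, (P.gap x j - P.R / n) ^ 2 +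
      ∑ i, (speed x i - P.vstar) ^ 2 := by
    rw [EuclideanSpace.real_norm_sq_eq, Fintype.sum_sum_type]
    simp [gap_inl, equilibrium, speed]
  linarith

theorem gap_equilibrium (P : RingRoad) (i : Fin n) : P.gap (P.equilibrium n) i = P.R / n := by
  have hn : (n : ℝ) ≠ 0 := by exact_mod_cast NeZero.ne n
  have hne : ∀ j : {i : Fin n // i ≠ 0}, P.gap (P.equilibrium n) j = P.R / n := fun j => by
    rw [gap_inl]; rfl
  by_cases hi : i = 0
  · have h := Fintype.sum_subtype_ne_eq_sub (fun i => P.gap (P.equilibrium n) i - P.R / n) 0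
    have h1 := P.sum_gap (P.equilibrium n)
    simp only [hne, sub_self, Finset.sum_const_zero, Finset.sum_sub_distrib, h1, Finset.sum_const,
      Finset.card_univ, Fintype.card_fin, nsmul_eq_mul] at h
    rw [mul_div_cancel₀ _ hn] at h
    rw [hi]
    linarith
  · exact hne ⟨i, hi⟩

theorem speed_equilibrium (P : RingRoad) (i : Fin n) : speed (P.equilibrium n) i = P.vstar := rfl

theorem forceDiff_equilibrium (P : RingRoad) (i : Fin n) :
    P.forceDiff (P.equilibrium n) i = 0 := by
  simp [forceDiff, gap_equilibrium]

theorem sum_forceDiff (P : RingRoad) (x : State n) : ∑ i, P.forceDiff x i = 0 := by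
  simp only [forceDiff, Finset.sum_sub_distrib]
  rw [Fin.sum_comp_add_one (fun i => deriv P.V (P.gap x i)), sub_self]

theorem sum_gap_sub (P : RingRoad) (x : State n) : ∑ i, (P.gap x i - P.R / n) = 0 := by
  have hn : (n : ℝ) ≠ 0 := by exact_mod_cast NeZero.ne n
  simp [Finset.sum_sub_distrib, sum_gap, mul_div_cancel₀ _ hn]

/-- The linear terms of the excesses cancel because the deviations of the gaps from R/n sum to zero.
In this form positivity can be seen term by term. -/
theorem lyapunovU_eq (P : RingRoad) (x : State n) : P.lyapunovU x = P.vmax ^ 2 / 2 *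
      ∑ i : Fin n, (speed x i - P.desiredSpeed x i) ^ 2 / (speed x i * (P.vmax - speed x i)) +
    ∑ i : Fin n, P.excess n (P.gap x i) := by
  simp only [lyapunovU, lyapunovH, excess, Finset.sum_sub_distrib (fun i => _ - _),
    Finset.sum_sub_distrib (fun i => P.V (P.gap x i)), ← Finset.mul_sum, sum_gap_sub]
  simp
  ring

/-! ### Smoothness -/

theorem contDiff_speed (i : Fin n) {m : WithTop ℕ∞} :
    ContDiff ℝ m (fun x : State n => speed x i) := by
  unfold speed; fun_prop

theorem contDiff_gap (P : RingRoad) (i : Fin n) {m : WithTop ℕ∞} :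
    ContDiff ℝ m (fun x : State n => P.gap x i) := by
  by_cases hi : i = 0
  · simp only [gap, dif_pos hi]; fun_prop
  · simp only [gap, dif_neg hi]; fun_prop

theorem isOpen_stateSpace (P : RingRoad) : IsOpen (P.stateSpace n) := by
  have : P.stateSpace n = (⋂ i, {x | P.L < P.gap x i}) ∩
      ⋂ i, ({x | 0 < speed x i} ∩ {x | speed x i < P.vmax}) := by
    ext x; simp [mem_stateSpace_iff]
  rw [this]
  refine (isOpen_iInter_of_finite fun i => isOpen_lt continuous_const
    (P.contDiff_gap i (m := 0)).continuous).inter (isOpen_iInter_of_finite fun i => ?_)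
  have hs := (contDiff_speed i (n := n) (m := 0)).continuous
  exact (isOpen_lt continuous_const hs).inter (isOpen_lt hs continuous_const)

/-- The derivative of U along the field is computed on straight lines, where all gaps are affine.
The gap with index 0 follows the same law because the speed differences telescope around the ring.
-/
theorem gap_add_smul_closedLoop (P : RingRoad) (x : State n) (τ : ℝ) (i : Fin n) :
    P.gap (x + τ • P.closedLoop x) i = P.gap x i + τ * (speed x (i - 1) - speed x i) := by
  have hne : ∀ j : {i : Fin n // i ≠ 0}, P.gap (x + τ • P.closedLoop x) j =
      P.gap x j + τ * (speed x (j - 1) - speed x j) := fun j => by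
    rw [gap_inl, gap_inl]; rfl
  by_cases hi : i = 0
  · have h := Fintype.sum_subtype_ne_eq_sub
      (fun i => P.gap (x + τ • P.closedLoop x) i -
        (P.gap x i + τ * (speed x (i - 1) - speed x i))) 0
    simp only [hne, sub_self, Finset.sum_const_zero, Finset.sum_sub_distrib,
      Finset.sum_add_distrib, sum_gap, ← Finset.mul_sum, Fin.sum_comp_sub_one (speed x)] at h
    rw [hi]
    linarith
  · exact hne ⟨i, hi⟩

theorem speed_add_smul_closedLoop (P : RingRoad) (x : State n) (τ : ℝ) (i : Fin n) :
    speed (x + τ • P.closedLoop x) i = speed x i + τ * P.controller x i := rfl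

namespace IsAdmissible

theorem contDiffOn_forceDiff (h : P.IsAdmissible n) (i : Fin n) :
    ContDiffOn ℝ 2 (fun x : State n => P.forceDiff x i) {x | ∀ i, P.L < P.gap x i} := by
  have hm : ∀ i, MapsTo (fun x : State n => P.gap x i) {x | ∀ i, P.L < P.gap x i} (Ioi P.L) :=
    fun i x hx => hx i
  exact (h.contDiffOn_deriv_V.comp (P.contDiff_gap (i + 1)).contDiffOn (hm (i + 1))).sub
    (h.contDiffOn_deriv_V.comp (P.contDiff_gap i).contDiffOn (hm i))

theorem contDiffOn_desiredSpeed (h : P.IsAdmissible n) (i : Fin n) :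
    ContDiffOn ℝ 2 (fun x : State n => P.desiredSpeed x i) {x | ∀ i, P.L < P.gap x i} :=
  contDiffOn_const.sub (h.contDiff_b.comp_contDiffOn (h.contDiffOn_forceDiff i))

theorem desiredSpeed_pos (h : P.IsAdmissible n) (x : State n) (i : Fin n) :
    0 < P.desiredSpeed x i := by
  have := (h.b_range (P.forceDiff x i)).2
  unfold desiredSpeed; linarith

theorem desiredSpeed_lt (h : P.IsAdmissible n) (x : State n) (i : Fin n) :
    P.desiredSpeed x i < P.vmax := by
  have := (h.b_range (P.forceDiff x i)).1
  unfold desiredSpeed; linarith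

theorem stateSpace_subset (P : RingRoad) : P.stateSpace n ⊆ {x | ∀ i, P.L < P.gap x i} :=
  fun _ hx => (mem_stateSpace_iff.1 hx).1

theorem speed_mul_pos {x : State n} (hx : x ∈ P.stateSpace n) (i : Fin n) :
    0 < speed x i * (P.vmax - speed x i) := by
  have := (mem_stateSpace_iff.1 hx).2 i
  exact mul_pos this.1 (sub_pos.2 this.2)

theorem contDiffOn_quotient (h : P.IsAdmissible n) (i : Fin n) :
    ContDiffOn ℝ 2 (fun x : State n => (speed x i - P.desiredSpeed x i) ^ 2 /
      (speed x i * (P.vmax - speed x i))) (P.stateSpace n) := by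
  have hv := (contDiff_speed i (n := n) (m := 2)).contDiffOn (s := P.stateSpace n)
  refine ((hv.sub ((h.contDiffOn_desiredSpeed i).mono (stateSpace_subset P))).pow 2).div
    (hv.mul (contDiffOn_const.sub hv)) fun x hx => (speed_mul_pos hx i).ne'

theorem contDiffOn_lyapunovU (h : P.IsAdmissible n) :
    ContDiffOn ℝ 2 (fun x : State n => P.lyapunovU x) (P.stateSpace n) := by
  refine ContDiffOn.sub (ContDiffOn.add (contDiffOn_const.mul
    (ContDiffOn.sum fun i _ => h.contDiffOn_quotient i)) (ContDiffOn.sum fun i _ => ?_))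
    contDiffOn_const
  exact (h.contDiffOn_V.of_le (by norm_num)).comp (P.contDiff_gap i).contDiffOn
    fun x hx => stateSpace_subset P hx i

theorem continuousOn_dissipation (h : P.IsAdmissible n) :
    ContinuousOn (fun x : State n => P.dissipation x) (P.stateSpace n) := by
  have hd := fun i => ((h.contDiffOn_forceDiff (n := n) i).mono (stateSpace_subset P)).continuousOn
  refine ContinuousOn.add (continuousOn_const.mul
    (continuousOn_finsetSum _ fun i _ => (h.contDiffOn_quotient i).continuousOn))
    (continuousOn_finsetSum _ fun i _ => ?_)
  exact (h.contDiff_b.continuous.comp_continuousOn (hd i)).mul (hd i)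

theorem contDiffOn_controller (h : P.IsAdmissible n) (i : Fin n) :
    ContDiffOn ℝ 1 (fun x : State n => P.controller x i) (P.stateSpace n) := by
  have hv := fun i => (contDiff_speed i (n := n) (m := 1)).contDiffOn (s := P.stateSpace n)
  have hf := ((h.contDiffOn_desiredSpeed (n := n) i).mono (stateSpace_subset P)).of_le
    (m := 1) (by norm_num)
  have hd := ((h.contDiffOn_forceDiff (n := n) i).mono (stateSpace_subset P)).of_le
    (m := 1) (by norm_num)
  have hg := fun i => (P.contDiff_gap i (n := n) (m := 1)).contDiffOn (s := P.stateSpace n)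
  have hV1 := fun i : Fin n => (h.contDiffOn_deriv_V.of_le (m := 1) (by norm_num)).comp (hg i)
    fun x hx => stateSpace_subset P hx i
  have hV2 := fun i : Fin n => h.contDiffOn_deriv_deriv_V.comp (hg i)
    fun x hx => stateSpace_subset P hx i
  have hbeta : ContDiffOn ℝ 1 (fun x : State n => P.beta (speed x i) (P.desiredSpeed x i))
      (P.stateSpace n) := by
    refine ((contDiffOn_const.mul ((hv i).add hf)).sub ((contDiffOn_const.mul hf).mul (hv i))).div
      ((contDiffOn_const.mul ((contDiffOn_const.sub (hv i)).pow 2)).mul ((hv i).pow 2))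
      fun x hx => ?_
    have := (mem_stateSpace_iff.1 hx).2 i
    have h1 := this.1
    have h2 := sub_pos.2 this.2
    positivity
  have hvisc : ContDiffOn ℝ 1 (fun x : State n => P.viscosity x i) (P.stateSpace n) :=
    (contDiffOn_const.mul (h.contDiff_deriv_b.comp_contDiffOn hd)).mul
      (((hV2 (i + 1)).mul ((hv i).sub (hv (i + 1)))).sub
        ((hV2 i).mul ((hv (i - 1)).sub (hv i))))
  refine (contDiffOn_const.div hbeta fun x hx => ?_).mul
    (((((hvisc.sub (contDiffOn_const.mul ((hv i).sub hf))).div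
      ((hv i).mul (contDiffOn_const.sub (hv i)))
      fun x hx => (speed_mul_pos hx i).ne').add (hV1 i))).sub (hV1 (i + 1)))
  have := (mem_stateSpace_iff.1 hx).2 i
  exact (h.beta_pos this.1 this.2 (h.desiredSpeed_pos x i) (h.desiredSpeed_lt x i)).ne'

theorem contDiffOn_closedLoop (h : P.IsAdmissible n) :
    ContDiffOn ℝ 1 (P.closedLoop (n := n)) (P.stateSpace n) := by
  rw [contDiffOn_euclidean]
  rintro (j | i)
  · exact ((contDiff_speed _).sub (contDiff_speed _)).contDiffOn
  · exact h.contDiffOn_controller i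

/-! ### The derivative of the Lyapunov function -/

/-- The design of the controller shows here. Differentiating the quotient produces exactly β as the
coefficient of the acceleration, and the viscosity is v_max² times the derivative of the desired
speed, so it cancels. What remains is damping and a force term. -/
theorem hasDerivAt_quotient_line (h : P.IsAdmissible n) {x : State n} (hx : x ∈ P.stateSpace n)
    (i : Fin n) :
    HasDerivAt (fun τ : ℝ => P.vmax ^ 2 / 2 * ((speed (x + τ • P.closedLoop x) i -
      P.desiredSpeed (x + τ • P.closedLoop x) i) ^ 2 / (speed (x + τ • P.closedLoop x) i *
        (P.vmax - speed (x + τ • P.closedLoop x) i))))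
      (-(P.mu * P.vmax ^ 2 * ((speed x i - P.desiredSpeed x i) ^ 2 /
        (speed x i * (P.vmax - speed x i)))) - (speed x i - P.desiredSpeed x i) *
          P.forceDiff x i) 0 := by
  have hgap : ∀ i, HasDerivAt (fun τ : ℝ => P.gap (x + τ • P.closedLoop x) i)
      (speed x (i - 1) - speed x i) 0 := fun i => by
    simp only [gap_add_smul_closedLoop]
    simpa using ((hasDerivAt_id (0 : ℝ)).mul_const (speed x (i - 1) - speed x i)).const_add
      (P.gap x i)
  have hspeed : HasDerivAt (fun τ : ℝ => speed (x + τ • P.closedLoop x) i)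
      (P.controller x i) 0 := by
    simp only [speed_add_smul_closedLoop]
    simpa using ((hasDerivAt_id (0 : ℝ)).mul_const (P.controller x i)).const_add (speed x i)
  have hx0 : x + (0 : ℝ) • P.closedLoop x = x := by simp
  have hV1 : ∀ i, HasDerivAt (fun τ : ℝ => deriv P.V (P.gap (x + τ • P.closedLoop x) i))
      (deriv (deriv P.V) (P.gap x i) * (speed x (i - 1) - speed x i)) 0 := fun i =>
    HasDerivAt.comp (0 : ℝ) (h := fun τ : ℝ => P.gap (x + τ • P.closedLoop x) i)
      (h₂ := deriv P.V) (by rw [hx0]; exact h.hasDerivAt_deriv_V (stateSpace_subset P hx i)) (hgap i)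
  have hd : HasDerivAt (fun τ : ℝ => P.forceDiff (x + τ • P.closedLoop x) i)
      (deriv (deriv P.V) (P.gap x (i + 1)) * (speed x i - speed x (i + 1)) -
        deriv (deriv P.V) (P.gap x i) * (speed x (i - 1) - speed x i)) 0 := by
    have := (hV1 (i + 1)).sub (hV1 i)
    rwa [add_sub_cancel_right] at this
  set δ := deriv (deriv P.V) (P.gap x (i + 1)) * (speed x i - speed x (i + 1)) -
        deriv (deriv P.V) (P.gap x i) * (speed x (i - 1) - speed x i) with hδ
  have hf : HasDerivAt (fun τ : ℝ => P.desiredSpeed (x + τ • P.closedLoop x) i)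
      (-(deriv P.b (P.forceDiff x i) * δ)) 0 := by
    have := (HasDerivAt.comp (0 : ℝ) (by rw [hx0]; exact h.hasDerivAt_b _) hd).const_sub P.vstar
    exact this
  set φ := -(deriv P.b (P.forceDiff x i) * δ) with hφ
  have hvisc : P.viscosity x i = P.vmax ^ 2 * φ := by
    rw [hφ, hδ, viscosity]; ring
  have hp := speed_mul_pos hx i
  have hv := (mem_stateSpace_iff.1 hx).2 i
  have hv1 : speed x i ≠ 0 := hv.1.ne'
  have hv2 : P.vmax - speed x i ≠ 0 := (sub_pos.2 hv.2).ne'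
  have hβ := h.beta_pos hv.1 hv.2 (h.desiredSpeed_pos x i) (h.desiredSpeed_lt x i)
  have hF : P.beta (speed x i) (P.desiredSpeed x i) * P.controller x i =
      (P.vmax ^ 2 * φ - P.mu * P.vmax ^ 2 * (speed x i - P.desiredSpeed x i)) /
        (speed x i * (P.vmax - speed x i)) - P.forceDiff x i := by
    rw [controller, hvisc, ← mul_assoc, mul_one_div_cancel hβ.ne', forceDiff]
    ring
  have hq := (((hspeed.sub hf).pow 2).div (hspeed.mul (hspeed.const_sub P.vmax))
    (by simpa only [Pi.mul_apply, hx0] using hp.ne')).const_mul (P.vmax ^ 2 / 2)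
  refine hq.congr_deriv ?_
  simp only [Pi.sub_apply, Pi.mul_apply, Pi.pow_apply, hx0]
  set v := speed x i
  set f := P.desiredSpeed x i
  set F := P.controller x i
  have key : P.vmax ^ 2 / 2 * ((2 * (v - f) * (F - φ) * (v * (P.vmax - v)) -
      (v - f) ^ 2 * (F * (P.vmax - v) + v * (-F))) / (v * (P.vmax - v)) ^ 2) =
      (v - f) * (P.beta v f * F - P.vmax ^ 2 * φ / (v * (P.vmax - v))) := by
    rw [beta]; field_simp; ring
  calc _ = P.vmax ^ 2 / 2 * ((2 * (v - f) * (F - φ) * (v * (P.vmax - v)) -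
      (v - f) ^ 2 * (F * (P.vmax - v) + v * (-F))) / (v * (P.vmax - v)) ^ 2) := by norm_num
    _ = _ := by rw [key, hF]; field_simp; ring

/-- Summation by parts around the ring turns the derivative of the potential energy into the sum of
v_i d_i, where d_i is `forceDiff`, which cancels against the force terms. The v* part drops out
because the d_i sum to zero, leaving -b(d_i) d_i. -/
theorem hasDerivAt_lyapunovU_line (h : P.IsAdmissible n) {x : State n} (hx : x ∈ P.stateSpace n) :
    HasDerivAt (fun τ : ℝ => P.lyapunovU (x + τ • P.closedLoop x)) (-P.dissipation x) 0 := by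
  have hV : ∀ i, HasDerivAt (fun τ : ℝ => P.V (P.gap (x + τ • P.closedLoop x) i))
      (deriv P.V (P.gap x i) * (speed x (i - 1) - speed x i)) 0 := fun i => by
    refine HasDerivAt.comp (0 : ℝ) (h := fun τ : ℝ => P.gap (x + τ • P.closedLoop x) i)
      (by simpa using h.hasDerivAt_V (stateSpace_subset P hx i)) ?_
    simp only [gap_add_smul_closedLoop]
    simpa using ((hasDerivAt_id (0 : ℝ)).mul_const (speed x (i - 1) - speed x i)).const_add
      (P.gap x i)
  have hsum := ((HasDerivAt.fun_sum fun i (_ : i ∈ Finset.univ) =>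
    h.hasDerivAt_quotient_line hx i).add
      (HasDerivAt.fun_sum fun i (_ : i ∈ Finset.univ) => hV i)).sub_const (n * P.V (P.R / n))
  refine (hsum.congr_deriv ?_).congr_of_eventuallyEq (Eventually.of_forall fun τ => ?_)
  · have h1 : ∑ i, deriv P.V (P.gap x i) * (speed x (i - 1) - speed x i) =
        ∑ i, speed x i * P.forceDiff x i := by
      have := Fin.sum_comp_add_one fun i => deriv P.V (P.gap x i) * speed x (i - 1)
      simp only [add_sub_cancel_right] at this
      simp only [forceDiff, mul_sub, Finset.sum_sub_distrib, ← this]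
      simp only [mul_comm]
    have h2 : ∑ i, (speed x i - P.desiredSpeed x i) * P.forceDiff x i =
        ∑ i, speed x i * P.forceDiff x i + ∑ i, P.b (P.forceDiff x i) * P.forceDiff x i := by
      have : ∀ i, (speed x i - P.desiredSpeed x i) * P.forceDiff x i =
          speed x i * P.forceDiff x i + P.b (P.forceDiff x i) * P.forceDiff x i -
            P.vstar * P.forceDiff x i := fun i => by rw [desiredSpeed]; ring
      simp only [this, Finset.sum_sub_distrib, Finset.sum_add_distrib, ← Finset.mul_sum,
        sum_forceDiff, mul_zero, sub_zero]
    rw [h1, Finset.sum_sub_distrib, h2, Finset.sum_neg_distrib, ← Finset.mul_sum, dissipation]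
    ring
  · simp only [lyapunovU, lyapunovH, Finset.mul_sum, Pi.add_apply]

theorem lyapunovU_deriv (h : P.IsAdmissible n) (x : State n) (hx : x ∈ P.stateSpace n) :
    DifferentiableAt ℝ (P.lyapunovU (n := n)) x ∧
      fderiv ℝ P.lyapunovU x (P.closedLoop x) = -P.dissipation x := by
  have hdiff : DifferentiableAt ℝ (P.lyapunovU (n := n)) x :=
    (h.contDiffOn_lyapunovU.contDiffAt (P.isOpen_stateSpace.mem_nhds hx)).differentiableAt
      (by norm_num)
  refine ⟨hdiff, ?_⟩
  have hline : HasDerivAt (fun τ : ℝ => x + τ • P.closedLoop x) (P.closedLoop x) 0 := by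
    simpa using ((hasDerivAt_id (0 : ℝ)).smul_const (P.closedLoop x)).const_add x
  have h1 := HasFDerivAt.comp_hasDerivAt (0 : ℝ) (l := P.lyapunovU)
    (by simpa using hdiff.hasFDerivAt) hline
  exact h1.unique (h.hasDerivAt_lyapunovU_line hx)

/-! ### Positivity and compactness -/

theorem quotient_nonneg {x : State n} (hx : x ∈ P.stateSpace n) (i : Fin n) :
    0 ≤ (speed x i - P.desiredSpeed x i) ^ 2 / (speed x i * (P.vmax - speed x i)) :=
  div_nonneg (sq_nonneg _) (speed_mul_pos hx i).le

theorem eq_equilibrium (h : P.IsAdmissible n) {x : State n}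
    (hg : ∀ i, P.gap x i = P.R / n) (hv : ∀ i, speed x i = P.desiredSpeed x i) :
    x = P.equilibrium n := by
  have h2 : ∀ i, speed x i = P.vstar := fun i => by
    rw [hv, desiredSpeed, forceDiff, hg, hg, sub_self, h.b_zero, sub_zero]
  have := P.norm_sub_equilibrium_sq x
  simp only [hg, h2, sub_self, ne_eq, OfNat.ofNat_ne_zero, not_false_eq_true, zero_pow,
    Finset.sum_const_zero, add_zero] at this
  exact sub_eq_zero.1 (norm_eq_zero.1 (pow_eq_zero_iff two_ne_zero |>.1
    (this.antisymm (sq_nonneg _))))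

theorem speed_eq_of_sum_quotient_nonpos {x : State n} (hx : x ∈ P.stateSpace n)
    (h0 : ∑ i : Fin n, (speed x i - P.desiredSpeed x i) ^ 2 /
      (speed x i * (P.vmax - speed x i)) ≤ 0) (i : Fin n) : speed x i = P.desiredSpeed x i := by
  have h1 := (Finset.sum_eq_zero_iff_of_nonneg fun i _ => quotient_nonneg hx i).1
    (h0.antisymm (Finset.sum_nonneg fun i _ => quotient_nonneg hx i)) i (Finset.mem_univ i)
  rw [div_eq_zero_iff] at h1
  exact sub_eq_zero.1 (pow_eq_zero_iff two_ne_zero |>.1 (h1.resolve_right (speed_mul_pos hx i).ne'))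

theorem lyapunovU_pos (h : P.IsAdmissible n) {x : State n} (hx : x ∈ P.stateSpace n)
    (hne : x ≠ P.equilibrium n) : 0 < P.lyapunovU x := by
  by_contra! hle
  have hg := fun i => h.excess_nonneg (stateSpace_subset P hx i)
  have hs1 := Finset.sum_nonneg fun i (_ : i ∈ Finset.univ) => hg i
  have hs2 := Finset.sum_nonneg fun i (_ : i ∈ Finset.univ) => quotient_nonneg hx i
  have hc : 0 < P.vmax ^ 2 / 2 := by have := h.vmax_pos; positivity
  rw [lyapunovU_eq] at hle
  have := mul_nonneg hc.le hs2
  refine hne (h.eq_equilibrium (fun i => ?_) (speed_eq_of_sum_quotient_nonpos hx ?_))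
  · by_contra hi
    have h1 := (Finset.sum_eq_zero_iff_of_nonneg fun i _ => hg i).1 (by linarith) i
      (Finset.mem_univ i)
    exact (h.excess_pos (stateSpace_subset P hx i) hi).ne' h1
  · exact nonpos_of_mul_nonpos_right (by linarith) hc

theorem dissipation_nonneg (h : P.IsAdmissible n) (x : State n) (hx : x ∈ P.stateSpace n) :
    0 ≤ P.dissipation x := by
  have h1 := h.mu_pos
  exact add_nonneg (mul_nonneg (by positivity) (Finset.sum_nonneg fun i _ => quotient_nonneg hx i))
    (Finset.sum_nonneg fun i _ => h.mul_b_nonneg _)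

/-- All V'(s_i) share one value, so the products (V'(s_i) - V'(R/n)) (s_i - R/n) have a common first
factor and sum to zero. Each is positive unless s_i = R/n. -/
theorem gap_eq_of_forceDiff_eq_zero (h : P.IsAdmissible n) {x : State n}
    (hx : x ∈ P.stateSpace n) (hd : ∀ i, P.forceDiff x i = 0) (i : Fin n) :
    P.gap x i = P.R / n := by
  have hconst := Fin.eq_apply_zero_of_apply_add_one_eq (g := fun i => deriv P.V (P.gap x i))
    fun i => sub_eq_zero.1 (hd i)
  set c := deriv P.V (P.gap x 0) - deriv P.V (P.R / n) with hc
  have hsum : ∑ i, c * (P.gap x i - P.R / n) = 0 := by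
    rw [← Finset.mul_sum, sum_gap_sub, mul_zero]
  have hterm : ∀ i, c * (P.gap x i - P.R / n) =
      (deriv P.V (P.gap x i) - deriv P.V (P.R / n)) * (P.gap x i - P.R / n) := fun i => by
    rw [hconst i]
  have hpos : ∀ i, P.gap x i ≠ P.R / n → 0 < c * (P.gap x i - P.R / n) := fun i hi => by
    rw [hterm]; exact h.deriv_V_sub_mul_pos (stateSpace_subset P hx i) hi
  have hnn : ∀ i, 0 ≤ c * (P.gap x i - P.R / n) := fun i => by
    by_cases hi : P.gap x i = P.R / n
    · simp [hi]
    · exact (hpos i hi).le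
  by_contra hi
  exact (hpos i hi).ne' ((Finset.sum_eq_zero_iff_of_nonneg fun i _ => hnn i).1 hsum i
    (Finset.mem_univ i))

theorem dissipation_pos (h : P.IsAdmissible n) (x : State n) (hx : x ∈ P.stateSpace n)
    (hne : x ≠ P.equilibrium n) : 0 < P.dissipation x := by
  by_contra! hle
  have hb := fun i => h.mul_b_nonneg (P.forceDiff x i)
  have hs1 := Finset.sum_nonneg fun i (_ : i ∈ Finset.univ) => hb i
  have hs2 := Finset.sum_nonneg fun i (_ : i ∈ Finset.univ) => quotient_nonneg hx i
  have hc : 0 < P.mu * P.vmax ^ 2 := by have := h.vmax_pos; have := h.mu_pos; positivity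
  rw [dissipation] at hle
  have := mul_nonneg hc.le hs2
  refine hne (h.eq_equilibrium (h.gap_eq_of_forceDiff_eq_zero hx fun i => ?_)
    (speed_eq_of_sum_quotient_nonpos hx ?_))
  · by_contra hi
    have h1 := (Finset.sum_eq_zero_iff_of_nonneg fun i _ => hb i).1 (by linarith) i
      (Finset.mem_univ i)
    have h2 := h.b_sign _ hi
    rw [mul_comm] at h2
    exact h2.ne' h1
  · exact nonpos_of_mul_nonpos_right (by linarith) hc

theorem norm_sub_equilibrium_sq_le (h : P.IsAdmissible n) {x : State n}
    (hg : ∀ i, 0 ≤ P.gap x i) (hv : ∀ i, 0 ≤ speed x i ∧ speed x i ≤ P.vmax) :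
    ‖x - P.equilibrium n‖ ^ 2 ≤ n * P.R ^ 2 + n * P.vmax ^ 2 := by
  refine (P.norm_sub_equilibrium_sq x).trans (add_le_add ?_ ?_)
  · have : ∀ i, (P.gap x i - P.R / n) ^ 2 ≤ P.R ^ 2 := fun i => by
      have h1 : P.gap x i ≤ P.R := by
        rw [← P.sum_gap x]
        exact Finset.single_le_sum (fun j _ => hg j) (Finset.mem_univ i)
      have h2 : 0 ≤ P.R / n := (h.L_pos.trans h.L_lt).le
      have h3 : P.R / n ≤ P.R := div_le_self h.R_pos.le (by
        exact_mod_cast (one_le_two.trans h.two_le))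
      have := hg i
      exact sq_le_sq' (by linarith) (by linarith)
    simpa using Finset.sum_le_sum fun i (_ : i ∈ Finset.univ) => this i
  · have : ∀ i, (speed x i - P.vstar) ^ 2 ≤ P.vmax ^ 2 := fun i =>
      sq_le_sq' (by linarith [(hv i).1, h.vstar_lt]) (by linarith [(hv i).2, h.vstar_pos])
    simpa using Finset.sum_le_sum fun i (_ : i ∈ Finset.univ) => this i

/-- A bound on U keeps the gaps above some ℓ > L, since V blows up at L, and bounds each quotient by
C. Clearing denominators gives a condition that is closed up to speeds 0 and v_max, yet excludes
these values because the desired speed is neither. The sublevel set is thus closed in a compact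
subset of Ω. -/
theorem isCompact_sublevel (h : P.IsAdmissible n) (c : ℝ) :
    IsCompact {x : State n | x ∈ P.stateSpace n ∧ P.lyapunovU x ≤ c} := by
  set c' := c + n * P.V (P.R / n) with hc'
  obtain ⟨ℓ, hℓ, hVℓ⟩ : ∃ ℓ, P.L < ℓ ∧ ∀ s, P.L < s → P.V s ≤ c' → ℓ ≤ s := by
    obtain ⟨u, hu, hsub⟩ := mem_nhdsGT_iff_exists_Ioo_subset.1
      (h.tendsto_V.eventually (eventually_gt_atTop c'))
    refine ⟨u, hu, fun s hs hVs => ?_⟩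
    by_contra! hlt
    exact absurd (hsub ⟨hs, hlt⟩) (not_lt.2 hVs)
  have hvm := h.vmax_pos
  set C := c' / (P.vmax ^ 2 / 2) with hC
  set A := {x : State n | ∀ i, ℓ ≤ P.gap x i} with hA
  have hAc : IsClosed A := by
    rw [hA, ofPred_forall]
    exact isClosed_iInter fun i => isClosed_le continuous_const (P.contDiff_gap i (m := 0)).continuous
  have hAsub : A ⊆ {x | ∀ i, P.L < P.gap x i} := fun x hx i => hℓ.trans_le (hx i)
  set K := A ∩ {x : State n | ∀ i, 0 ≤ speed x i ∧ speed x i ≤ P.vmax ∧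
    (speed x i - P.desiredSpeed x i) ^ 2 - C * (speed x i * (P.vmax - speed x i)) ≤ 0} with hK
  have hs := fun i : Fin n => (contDiff_speed i (n := n) (m := 0)).continuous
  have hKc : IsClosed K := by
    have : K = ⋂ i, ({x | 0 ≤ speed x i} ∩ {x | speed x i ≤ P.vmax} ∩
        (A ∩ (fun x : State n => (speed x i - P.desiredSpeed x i) ^ 2 -
          C * (speed x i * (P.vmax - speed x i))) ⁻¹' Iic 0)) := by
      ext x
      simp only [hK, mem_inter_iff, mem_ofPred_eq, mem_iInter, mem_preimage, mem_Iic]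
      exact ⟨fun hx i => ⟨⟨(hx.2 i).1, (hx.2 i).2.1⟩, hx.1, (hx.2 i).2.2⟩,
        fun hx => ⟨(hx 0).2.1, fun i => ⟨(hx i).1.1, (hx i).1.2, (hx i).2.2⟩⟩⟩
    rw [this]
    refine isClosed_iInter fun i => ((isClosed_le continuous_const (hs i)).inter
      (isClosed_le (hs i) continuous_const)).inter ?_
    refine ContinuousOn.preimage_isClosed_of_isClosed ?_ hAc isClosed_Iic
    have hf := (h.contDiffOn_desiredSpeed (n := n) i).continuousOn.mono hAsub
    have hv := (hs i).continuousOn (s := A)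
    exact ((hv.sub hf).pow 2).sub (continuousOn_const.mul (hv.mul (continuousOn_const.sub hv)))
  have hKD : K ⊆ P.stateSpace n := by
    rintro x ⟨hxA, hx⟩
    refine mem_stateSpace_iff.2 ⟨hAsub hxA, fun i => ?_⟩
    obtain ⟨h1, h2, h3⟩ := hx i
    have hf0 := h.desiredSpeed_pos x i
    have hf1 := h.desiredSpeed_lt x i
    refine ⟨h1.lt_of_ne fun h0 => ?_, h2.lt_of_ne fun h0 => ?_⟩
    · rw [← h0] at h3; nlinarith
    · rw [h0] at h3; nlinarith
  have hKcomp : IsCompact K := by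
    refine (isCompact_closedBall (P.equilibrium n) (√(n * P.R ^ 2 + n * P.vmax ^ 2)))
      |>.of_isClosed_subset hKc fun x hx => ?_
    rw [mem_closedBall_iff_norm]
    refine Real.le_sqrt_of_sq_le (h.norm_sub_equilibrium_sq_le (fun i => ?_)
      fun i => ⟨(hx.2 i).1, (hx.2 i).2.1⟩)
    exact (h.L_pos.trans (hAsub hx.1 i)).le
  have heq : {x : State n | x ∈ P.stateSpace n ∧ P.lyapunovU x ≤ c} =
      K ∩ P.lyapunovU ⁻¹' Iic c := by
    ext x
    refine ⟨fun hx => ⟨⟨fun i => ?_, fun i => ?_⟩, hx.2⟩, fun hx => ⟨hKD hx.1, hx.2⟩⟩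
    all_goals
      have hH : P.lyapunovH x ≤ c' := by
        have := hx.2
        rw [lyapunovU] at this
        linarith
      have hg := stateSpace_subset P hx.1
      have h1 := Finset.sum_nonneg fun i (_ : i ∈ Finset.univ) => quotient_nonneg hx.1 i
      have h2 := Finset.sum_nonneg fun i (_ : i ∈ Finset.univ) => h.V_nonneg _ (hg i)
      have h3 := Finset.single_le_sum (fun i _ => quotient_nonneg hx.1 i) (Finset.mem_univ i)
      have h4 := Finset.single_le_sum (fun i _ => h.V_nonneg _ (hg i)) (Finset.mem_univ i)
      have hc : 0 < P.vmax ^ 2 / 2 := by positivity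
      rw [lyapunovH] at hH
    · refine hVℓ _ (hg i) (h4.trans ?_)
      linarith [mul_nonneg hc.le h1]
    · have hv := (mem_stateSpace_iff.1 hx.1).2 i
      refine ⟨hv.1.le, hv.2.le, ?_⟩
      have h5 : (speed x i - P.desiredSpeed x i) ^ 2 / (speed x i * (P.vmax - speed x i)) ≤ C := by
        rw [hC, le_div_iff₀ hc, mul_comm]
        exact (mul_le_mul_of_nonneg_left h3 hc.le).trans (by linarith)
      rw [div_le_iff₀ (speed_mul_pos hx.1 i)] at h5
      linarith
  rw [heq]
  exact hKcomp.of_isClosed_subset (((h.contDiffOn_lyapunovU).continuousOn.mono hKD)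
    |>.preimage_isClosed_of_isClosed hKc isClosed_Iic) inter_subset_left

end IsAdmissible

end

end RingRoad

/-! ### Quadratic lower bound for U and the local decay rate. -/

/-- A positive definite function with compact sublevel sets on a bounded set that dominates the
squared distance near its zero dominates it everywhere, up to a factor. -/
theorem exists_sq_norm_le_mul {E : Type*} [NormedAddCommGroup E] {D : Set E} {U : E → ℝ} {xe : E}
    (hUc : ContinuousOn U D) (hcomp : ∀ c, IsCompact {x | x ∈ D ∧ U x ≤ c})
    (hpos : ∀ x ∈ D, x ≠ xe → 0 < U x) (hUe : U xe = 0) {B C : ℝ}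
    (hB : ∀ x ∈ D, ‖x - xe‖ ^ 2 ≤ B) (hloc : ∀ᶠ x in 𝓝 xe, x ∈ D → ‖x - xe‖ ^ 2 ≤ C * U x) :
    ∃ C', 0 < C' ∧ ∀ x ∈ D, ‖x - xe‖ ^ 2 ≤ C' * U x := by
  obtain ⟨ε, hε, hball⟩ := Metric.eventually_nhds_iff.1 hloc
  -- Outside the ball U ≥ `min m 1`: by compactness where U ≤ 1, trivially elsewhere. Boundedness of
  -- D then suffices there.
  set A := {x | x ∈ D ∧ U x ≤ 1} ∩ (Metric.ball xe ε)ᶜ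
  have hA : IsCompact A := (hcomp 1).inter_right Metric.isOpen_ball.isClosed_compl
  have hm : ∃ m, 0 < m ∧ ∀ x ∈ A, m ≤ U x := by
    rcases A.eq_empty_or_nonempty with h | h
    · exact ⟨1, one_pos, by simp [h]⟩
    · obtain ⟨z, hz, hmin⟩ := hA.exists_isMinOn h (hUc.mono fun x hx => hx.1.1)
      refine ⟨U z, hpos z hz.1.1 ?_, fun x hx => hmin hx⟩
      rintro rfl
      exact hz.2 (Metric.mem_ball_self hε)
  obtain ⟨m, hm, hmU⟩ := hm
  have hm' : 0 < min m 1 := lt_min hm one_pos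
  have hU0 : ∀ x ∈ D, 0 ≤ U x := fun x hx => by
    rcases eq_or_ne x xe with rfl | hne
    · exact hUe.ge
    · exact (hpos x hx hne).le
  refine ⟨|C| + |B| / min m 1 + 1, by positivity, fun x hx => ?_⟩
  have h0 := hU0 x hx
  by_cases hxb : x ∈ Metric.ball xe ε
  · refine (hball hxb hx).trans (mul_le_mul_of_nonneg_right ?_ h0)
    have : 0 ≤ |B| / min m 1 := by positivity
    linarith [le_abs_self C]
  · have h1 : min m 1 ≤ U x := by
      rcases le_or_gt (U x) 1 with h | h
      · exact (min_le_left _ _).trans (hmU x ⟨⟨hx, h⟩, hxb⟩)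
      · exact (min_le_right _ _).trans h.le
    calc ‖x - xe‖ ^ 2 ≤ |B| := (hB x hx).trans (le_abs_self B)
      _ = |B| / min m 1 * min m 1 := by field_simp
      _ ≤ |B| / min m 1 * U x := by gcongr
      _ ≤ _ := mul_le_mul_of_nonneg_right (by linarith [abs_nonneg C]) h0

namespace RingRoad

noncomputable section

variable {P : RingRoad} {n : ℕ} [NeZero n]

namespace IsAdmissible

theorem equilibrium_mem (h : P.IsAdmissible n) : P.equilibrium n ∈ P.stateSpace n :=
  mem_stateSpace_iff.2 ⟨fun i => by rw [gap_equilibrium]; exact h.L_lt,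
    fun i => by rw [speed_equilibrium]; exact ⟨h.vstar_pos, h.vstar_lt⟩⟩

theorem desiredSpeed_equilibrium (h : P.IsAdmissible n) (i : Fin n) :
    P.desiredSpeed (P.equilibrium n) i = P.vstar := by
  rw [desiredSpeed, forceDiff_equilibrium, h.b_zero, sub_zero]

theorem lyapunovU_equilibrium (h : P.IsAdmissible n) : P.lyapunovU (P.equilibrium n) = 0 := by
  simp [lyapunovU_eq, gap_equilibrium, speed_equilibrium, h.desiredSpeed_equilibrium, excess]

theorem closedLoop_equilibrium (h : P.IsAdmissible n) : P.closedLoop (P.equilibrium n) = 0 := by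
  ext (j | i)
  · simp [closedLoop, speed_equilibrium]
  · simp [closedLoop, controller, viscosity, gap_equilibrium, speed_equilibrium,
      h.desiredSpeed_equilibrium]

/-- Where the field vanishes, so does the derivative of U along it, which is minus a quantity
positive off the equilibrium. -/
theorem closedLoop_eq_zero_iff (h : P.IsAdmissible n) {x : State n} (hx : x ∈ P.stateSpace n) :
    P.closedLoop x = 0 ↔ x = P.equilibrium n := by
  refine ⟨fun h0 => ?_, fun he => he ▸ h.closedLoop_equilibrium⟩
  by_contra hne
  have := (h.lyapunovU_deriv x hx).2
  rw [h0, map_zero] at this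
  linarith [h.dissipation_pos x hx hne]

theorem eventually_near_equilibrium (h : P.IsAdmissible n) {ε : ℝ} (hε : 0 < ε)
    {p : ℝ → Prop} (hp : ∀ᶠ d in 𝓝 0, p d) :
    ∀ᶠ x in 𝓝 (P.equilibrium n), (∀ i, |P.gap x i - P.R / n| < ε) ∧ ∀ i, p (P.forceDiff x i) := by
  refine (eventually_all.2 fun i => ?_).and (eventually_all.2 fun i => ?_)
  · have hc : Tendsto (fun x : State n => P.gap x i) (𝓝 (P.equilibrium n)) (𝓝 (P.R / n)) := by
      have := (P.contDiff_gap i (n := n) (m := 0)).continuous.tendsto (P.equilibrium n)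
      rwa [gap_equilibrium] at this
    filter_upwards [hc.eventually (Metric.ball_mem_nhds _ hε)] with x hx
    rwa [Real.dist_eq] at hx
  · have hc : Tendsto (fun x : State n => P.forceDiff x i) (𝓝 (P.equilibrium n)) (𝓝 0) := by
      have := (((h.contDiffOn_forceDiff i).mono (stateSpace_subset P)).continuousOn.continuousAt
        (P.isOpen_stateSpace.mem_nhds h.equilibrium_mem)).tendsto
      rwa [forceDiff_equilibrium] at this
    exact hc.eventually hp

/-- Write v_i - v* = (v_i - f_i) - b(d_i), with d_i the force difference. The first term is
controlled by the quotient, as v (v_max - v) ≤ v_max² / 4; the second is of the order of the gap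
deviations, whose squares are controlled by the excesses. -/
theorem eventually_sq_norm_le (h : P.IsAdmissible n) :
    ∃ C, ∀ᶠ x in 𝓝 (P.equilibrium n), x ∈ P.stateSpace n →
      ‖x - P.equilibrium n‖ ^ 2 ≤ C * P.lyapunovU x := by
  obtain ⟨ε, hε, hV, hE⟩ := h.exists_local_bounds (k := 1 / 2) (by norm_num) (by norm_num)
  have hb := (h.hasDerivAt_b 0).eventually_mul_self_ge h.b_zero h.deriv_b_pos
    (k := 1 / 2) (by norm_num)
  set q := deriv (deriv P.V) (P.R / n)
  set c := deriv P.b 0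
  have hq : 0 < q := h.deriv_deriv_V_eq_pos
  have hc : 0 < c := h.deriv_b_pos
  -- Each speed contributes 64 c² q² times two squared gap deviations, and every gap is counted
  -- twice around the ring; the 1 is for the gaps themselves. The factor 4 / q below inverts the
  -- lower bound q / 4 of the excess.
  set D := 1 + 128 * c ^ 2 * q ^ 2 with hD
  refine ⟨1 + D * 4 / q, ?_⟩
  filter_upwards [h.eventually_near_equilibrium hε hb] with x hx hxD
  obtain ⟨hx1, hx2⟩ := hx
  set Q := fun i => (speed x i - P.desiredSpeed x i) ^ 2 / (speed x i * (P.vmax - speed x i))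
  set G := ∑ i, (P.gap x i - P.R / n) ^ 2 with hG
  have hG0 : 0 ≤ G := Finset.sum_nonneg fun i _ => sq_nonneg _
  have hQ0 : 0 ≤ ∑ i, Q i := Finset.sum_nonneg fun i _ => quotient_nonneg hxD i
  have hvm := h.vmax_pos
  have hspeed : ∀ i, (speed x i - P.vstar) ^ 2 ≤ P.vmax ^ 2 / 2 * Q i +
      64 * c ^ 2 * q ^ 2 * ((P.gap x (i + 1) - P.R / n) ^ 2 + (P.gap x i - P.R / n) ^ 2) := by
    intro i
    have hv := (mem_stateSpace_iff.1 hxD).2 i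
    have h1 : (speed x i - P.desiredSpeed x i) ^ 2 ≤ P.vmax ^ 2 / 4 * Q i := by
      have h2 : (speed x i - P.desiredSpeed x i) ^ 2 =
          speed x i * (P.vmax - speed x i) * Q i := by
        exact (mul_div_cancel₀ _ (speed_mul_pos hxD i).ne').symm
      rw [h2]
      refine mul_le_mul_of_nonneg_right ?_ (quotient_nonneg hxD i)
      nlinarith [sq_nonneg (P.vmax - 2 * speed x i)]
    have h3 : P.b (P.forceDiff x i) ^ 2 ≤ (2 * c) ^ 2 * P.forceDiff x i ^ 2 := by
      rw [← sq_abs (P.b _), ← sq_abs (P.forceDiff x i), ← mul_pow]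
      refine pow_le_pow_left₀ (abs_nonneg _) ((hx2 i).2.trans ?_) 2
      gcongr; norm_num
    have h4 : P.forceDiff x i ^ 2 ≤ (2 * q) ^ 2 * (P.gap x (i + 1) - P.gap x i) ^ 2 :=
      (hV _ _ (hx1 (i + 1)) (hx1 i)).2
    have h5 : (P.gap x (i + 1) - P.gap x i) ^ 2 ≤
        2 * ((P.gap x (i + 1) - P.R / n) ^ 2 + (P.gap x i - P.R / n) ^ 2) := by
      nlinarith [sq_nonneg (P.gap x (i + 1) - P.R / n + (P.gap x i - P.R / n))]
    have h6 : (speed x i - P.vstar) ^ 2 ≤ 2 * (speed x i - P.desiredSpeed x i) ^ 2 +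
        2 * P.b (P.forceDiff x i) ^ 2 := by
      have : speed x i - P.vstar =
          (speed x i - P.desiredSpeed x i) - P.b (P.forceDiff x i) := by
        rw [desiredSpeed]; ring
      rw [this]
      nlinarith [sq_nonneg (speed x i - P.desiredSpeed x i + P.b (P.forceDiff x i))]
    calc _ ≤ 2 * (P.vmax ^ 2 / 4 * Q i) + 2 * ((2 * c) ^ 2 * ((2 * q) ^ 2 *
        (2 * ((P.gap x (i + 1) - P.R / n) ^ 2 + (P.gap x i - P.R / n) ^ 2)))) := by
          refine h6.trans (add_le_add (by gcongr) ?_)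
          gcongr
          refine h3.trans ?_
          gcongr
          refine h4.trans ?_
          gcongr
      _ = _ := by ring
  have hsum := Finset.sum_le_sum fun i (_ : i ∈ Finset.univ) => hspeed i
  rw [Finset.sum_add_distrib, ← Finset.mul_sum, ← Finset.mul_sum, Finset.sum_add_distrib,
    Fin.sum_comp_add_one (fun i => (P.gap x i - P.R / n) ^ 2), ← hG] at hsum
  have hexc : q / 4 * G ≤ ∑ i, P.excess n (P.gap x i) := by
    rw [hG, Finset.mul_sum]
    refine Finset.sum_le_sum fun i _ => ?_
    have := (hE _ (hx1 i)).1
    linarith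
  have hexc0 := (mul_nonneg (by positivity : 0 ≤ q / 4) hG0).trans hexc
  have hGle : D * G ≤ D * 4 / q * ∑ i, P.excess n (P.gap x i) := by
    have : D * G = D * 4 / q * (q / 4 * G) := by field_simp
    rw [this]
    gcongr
  calc ‖x - P.equilibrium n‖ ^ 2 ≤ P.vmax ^ 2 / 2 * ∑ i, Q i + D * G := by
        refine (P.norm_sub_equilibrium_sq x).trans ?_
        rw [hD]
        linarith
    _ ≤ P.vmax ^ 2 / 2 * ∑ i, Q i + D * 4 / q * ∑ i, P.excess n (P.gap x i) := by gcongr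
    _ ≤ (1 + D * 4 / q) * P.lyapunovU x := by
        rw [lyapunovU_eq]
        have h7 : 0 ≤ D * 4 / q * (P.vmax ^ 2 / 2 * ∑ i, Q i) := by positivity
        linarith

theorem exists_sq_norm_le (h : P.IsAdmissible n) :
    ∃ C, 0 < C ∧ ∀ x ∈ P.stateSpace n, ‖x - P.equilibrium n‖ ^ 2 ≤ C * P.lyapunovU x := by
  obtain ⟨C, hC⟩ := h.eventually_sq_norm_le
  refine exists_sq_norm_le_mul (B := n * P.R ^ 2 + n * P.vmax ^ 2) h.contDiffOn_lyapunovU.continuousOn h.isCompact_sublevel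
    (fun x hx hne => h.lyapunovU_pos hx hne) h.lyapunovU_equilibrium (fun x hx => ?_) hC
  have := mem_stateSpace_iff.1 hx
  exact h.norm_sub_equilibrium_sq_le (fun i => (h.L_pos.trans (this.1 i)).le)
    fun i => ⟨(this.2 i).1.le, (this.2 i).2.le⟩

theorem rate_pos (h : P.IsAdmissible n) {θ : ℝ} (hθ : 0 < θ) : 0 < P.rate n θ := by
  have h1 := h.deriv_b_pos
  have h2 := h.deriv_deriv_V_eq_pos
  have h3 := muN_pos (n := n) h.two_le
  exact lt_min h.mu_pos (by positivity)

/-- The decay inequality near the equilibrium. -/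
theorem eventually_rate_mul_le (h : P.IsAdmissible n) {θ : ℝ} (hθ : 0 < θ) (hθ1 : θ < 1) :
    ∀ᶠ x in 𝓝 (P.equilibrium n), x ∈ P.stateSpace n →
      2 * P.rate n θ * P.lyapunovU x ≤ P.dissipation x := by
  -- The losses are k from b, k² from the squared differences of V', and a further k from the upper
  -- bound of the excess: in all k⁴ = θ².
  set k := √θ with hk
  have hk0 : 0 < k := Real.sqrt_pos.2 hθ
  have hk1 : k < 1 := by rw [hk, Real.sqrt_lt' one_pos]; simpa using hθ1
  have hkθ : k ^ 2 = θ := Real.sq_sqrt hθ.le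
  obtain ⟨ε, hε, hV, hE⟩ := h.exists_local_bounds hk0 hk1
  have hb := (h.hasDerivAt_b 0).eventually_mul_self_ge h.b_zero h.deriv_b_pos hk1
  set q := deriv (deriv P.V) (P.R / n) with hqdef
  set c := deriv P.b 0 with hcdef
  have hq : 0 < q := h.deriv_deriv_V_eq_pos
  have hc : 0 < c := h.deriv_b_pos
  have hM := muN_pos (n := n) h.two_le
  filter_upwards [h.eventually_near_equilibrium hε hb] with x hx hxD
  obtain ⟨hx1, hx2⟩ := hx
  set Q := ∑ i, (speed x i - P.desiredSpeed x i) ^ 2 / (speed x i * (P.vmax - speed x i)) with hQ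
  set G := ∑ i, (P.gap x i - P.R / n) ^ 2 with hG
  have hG0 : 0 ≤ G := Finset.sum_nonneg fun i _ => sq_nonneg _
  have hQ0 : 0 ≤ Q := Finset.sum_nonneg fun i _ => quotient_nonneg hxD i
  have hr := h.rate_pos hθ
  have hr1 : P.rate n θ ≤ P.mu := min_le_left _ _
  have hr2 : P.rate n θ ≤ θ ^ 2 * c * q * muN n := min_le_right _ _
  have hexc : ∑ i, P.excess n (P.gap x i) ≤ q / (2 * k) * G := by
    rw [hG, Finset.mul_sum]
    exact Finset.sum_le_sum fun i _ => (hE _ (hx1 i)).2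
  have hdiss : k * c * ((k * q) ^ 2 * (muN n * G)) ≤
      ∑ i, P.b (P.forceDiff x i) * P.forceDiff x i := by
    have h1 := muN_mul_sum_sq_le h.two_le (P.sum_gap_sub x)
    simp only [sub_sub_sub_cancel_right] at h1
    calc _ ≤ k * c * ((k * q) ^ 2 * ∑ i, (P.gap x (i + 1) - P.gap x i) ^ 2) := by gcongr
      _ = ∑ i, k * c * ((k * q) ^ 2 * (P.gap x (i + 1) - P.gap x i) ^ 2) := by
        simp only [Finset.mul_sum]
      _ ≤ _ := Finset.sum_le_sum fun i _ => by
        refine le_trans ?_ (hx2 i).1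
        gcongr
        exact (hV _ _ (hx1 (i + 1)) (hx1 i)).1
  have hgap : 2 * P.rate n θ * (q / (2 * k) * G) ≤ k * c * ((k * q) ^ 2 * (muN n * G)) := by
    calc 2 * P.rate n θ * (q / (2 * k) * G)
        ≤ 2 * (θ ^ 2 * c * q * muN n) * (q / (2 * k) * G) := by gcongr
      _ = _ := by rw [← hkθ]; field_simp
  have hspeed : 2 * P.rate n θ * (P.vmax ^ 2 / 2 * Q) ≤ P.mu * P.vmax ^ 2 * Q := by
    calc 2 * P.rate n θ * (P.vmax ^ 2 / 2 * Q) = P.rate n θ * (P.vmax ^ 2 * Q) := by ring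
      _ ≤ P.mu * (P.vmax ^ 2 * Q) := by gcongr
      _ = _ := by ring
  have hexc' := mul_le_mul_of_nonneg_left hexc (by positivity : 0 ≤ 2 * P.rate n θ)
  rw [lyapunovU_eq, dissipation, ← hQ, mul_add]
  linarith

/-- Exponential decay of the Lyapunov function. -/
theorem exists_lyapunovU_le_exp (h : P.IsAdmissible n) {θ : ℝ} (hθ : 0 < θ) (hθ1 : θ < 1) :
    ∃ G : ℝ → ℝ, IsClassKInfty G ∧ (∀ c, 0 ≤ c → c ≤ G c) ∧
      ∀ x : ℝ → State n, IsSolution P.closedLoop (P.stateSpace n) (Ici 0) x → ∀ t, 0 ≤ t →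
        P.lyapunovU (x t) ≤ Real.exp (-(2 * P.rate n θ) * t) * G (P.lyapunovU (x 0)) := by
  obtain ⟨C, hC, hCU⟩ := h.exists_sq_norm_le
  obtain ⟨ε, hε, hball⟩ := Metric.eventually_nhds_iff.1 (h.eventually_rate_mul_le hθ hθ1)
  -- By the bound ‖x - x*‖² ≤ C U this level set lies in the ball of radius ε, so the local decay
  -- inequality holds on a whole sublevel set.
  refine exists_classKInfty_exp_decay (r := ε ^ 2 / (2 * C)) h.lyapunovU_deriv
    h.isCompact_sublevel h.continuousOn_dissipation h.dissipation_nonneg h.dissipation_pos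
    h.lyapunovU_equilibrium
    (fun x hx => nonneg_of_mul_nonneg_right ((sq_nonneg _).trans (hCU x hx)) hC)
    (mul_pos two_pos (h.rate_pos hθ)) (by positivity) fun x hx hxr => hball ?_ hx
  rw [dist_eq_norm]
  refine lt_of_pow_lt_pow_left₀ 2 hε.le ((hCU x hx).trans_lt ?_)
  calc C * P.lyapunovU x ≤ C * (ε ^ 2 / (2 * C)) := by gcongr
    _ = ε ^ 2 / 2 := by field_simp
    _ < ε ^ 2 := half_lt_self (by positivity)

end IsAdmissible

end

end RingRoad
-- The main theorem.
theorem theorem3 (n : ℕ) [NeZero n] (hn : 2 ≤ n) (P : RingRoad)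
    -- the constants
    (hR : 0 < P.R) (hL : 0 < P.L) (hLR : P.L < P.R / n) (hLlam : P.L < P.lam)
    (hvmax : 0 < P.vmax) (hvstar : 0 < P.vstar ∧ P.vstar < P.vmax) (hmu : 0 < P.mu)
    -- the potential
    (hV : ContDiffOn ℝ 3 P.V (Ioi P.L))
    (hV_nonneg : ∀ x, P.L < x → 0 ≤ P.V x)
    (hV_lim : Tendsto P.V (𝓝[>] P.L) atTop)
    (hV_zero : ∀ x, P.lam ≤ x → P.V x = 0)
    (hV' : ∀ x, P.L < x → x < P.lam → deriv P.V x < 0)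
    (hV'' : ∀ x, P.L < x → x < P.lam → 0 < deriv (deriv P.V) x)
    -- the function b
    (hb : ContDiff ℝ 2 P.b) (hb_mono : Monotone P.b)
    (hb_range : ∀ x, P.vstar - P.vmax < P.b x ∧ P.b x < P.vstar)
    (hb_zero : P.b 0 = 0) (hb_sign : ∀ x, x ≠ 0 → 0 < x * P.b x) (hb' : 0 < deriv P.b 0)
    -- the length of the road
    (hRlam : P.R < n * P.lam) :
    -- the point (R/n, …, R/n, v*, …, v*) is the only equilibrium in the state space
    (P.equilibrium n ∈ P.stateSpace n ∧
      ∀ x ∈ P.stateSpace n, P.closedLoop x = 0 ↔ x = P.equilibrium n) ∧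
    -- every solution is defined for all t ≥ 0, and the equilibrium is uniformly globally
    -- asymptotically stable
    IsForwardComplete (P.closedLoop (n := n)) (P.stateSpace n) ∧
    IsUniformlyGloballyAsymptoticallyStable (P.closedLoop (n := n)) (P.stateSpace n)
      (P.equilibrium n) ∧
    -- the KL estimate in terms of U
    (∃ (σ : ℝ → ℝ → ℝ) (a : ℝ → ℝ), IsClassKL σ ∧ IsClassKInfty a ∧
      ∀ x : ℝ → RingRoad.State n, IsSolution P.closedLoop (P.stateSpace n) (Ici 0) x →
        ∀ t, 0 ≤ t →
          a ‖x t - P.equilibrium n‖ ≤ P.lyapunovU (x t) ∧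
          P.lyapunovU (x t) ≤ σ (P.lyapunovU (x 0)) t) ∧
    -- exponential convergence with the explicit rate
    (∀ θ : ℝ, 0 < θ → θ < 1 → 0 < P.rate n θ ∧
      ∃ κ : RingRoad.State n → ℝ, IsSizeFunction (P.stateSpace n) κ ∧ κ (P.equilibrium n) = 0 ∧
        ∀ x : ℝ → RingRoad.State n, IsSolution P.closedLoop (P.stateSpace n) (Ici 0) x →
          ∀ t, 0 ≤ t →
            ‖x t - P.equilibrium n‖ ≤ Real.exp (-(P.rate n θ) * t) * κ (x 0)) := by
  have hn0 : (0 : ℝ) < n := by exact_mod_cast (two_pos.trans_le hn)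
  have h : P.IsAdmissible n := ⟨hn, hR, hL, hLR, by rwa [div_lt_iff₀' hn0], hvmax, hvstar.1,
    hvstar.2, hmu, hV, hV_nonneg, hV_lim, hV_zero, hV', hV'', hb, hb_mono, hb_range, hb_zero,
    hb_sign, hb'⟩
  have hfc : IsForwardComplete (P.closedLoop (n := n)) (P.stateSpace n) :=
    isForwardComplete_of_lyapunov P.isOpen_stateSpace h.contDiffOn_closedLoop h.lyapunovU_deriv
      h.dissipation_nonneg h.isCompact_sublevel
  obtain ⟨C, hC, hCU⟩ := h.exists_sq_norm_le
  have hexp : ∀ θ : ℝ, 0 < θ → θ < 1 → ∃ κ : RingRoad.State n → ℝ,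
      IsSizeFunction (P.stateSpace n) κ ∧ κ (P.equilibrium n) = 0 ∧
        ∀ x : ℝ → RingRoad.State n, IsSolution P.closedLoop (P.stateSpace n) (Ici 0) x →
          ∀ t, 0 ≤ t →
            ‖x t - P.equilibrium n‖ ≤ Real.exp (-(P.rate n θ) * t) * κ (x 0) := by
    intro θ hθ hθ1
    obtain ⟨G, hG, hGle, hdecay⟩ := h.exists_lyapunovU_le_exp hθ hθ1
    exact exists_sizeFunction_exp_convergence h.lyapunovU_deriv h.isCompact_sublevel
      h.lyapunovU_equilibrium hC hCU hG hGle hdecay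
  refine ⟨⟨h.equilibrium_mem, fun x hx => h.closedLoop_eq_zero_iff hx⟩, hfc,
    ⟨h.equilibrium_mem, h.closedLoop_equilibrium, hfc, ?_⟩, ?_,
    fun θ hθ hθ1 => ⟨h.rate_pos hθ, hexp θ hθ hθ1⟩⟩
  -- Any θ in (0, 1) would do: an exponential estimate is already a KL estimate in the size function
  -- κ.
  · obtain ⟨κ, hκ, hκ0, hdecay⟩ := hexp (1 / 2) (by norm_num) (by norm_num)
    refine ⟨fun r t => Real.exp (-P.rate n (1 / 2) * t) * r, κ,
      isClassKL_exp_mul (G := fun r => r) ⟨continuousOn_id, strictMonoOn_id, rfl⟩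
        (h.rate_pos (by norm_num)), hκ, hκ0, hdecay⟩
  · obtain ⟨G, hG, -, hdecay⟩ := h.exists_lyapunovU_le_exp (θ := 1 / 2) (by norm_num) (by norm_num)
    -- The lower bound r² / C is the global inequality ‖x - x*‖² ≤ C U read backwards.
    refine ⟨fun r t => Real.exp (-(2 * P.rate n (1 / 2)) * t) * G r, fun r => r ^ 2 / C,
      isClassKL_exp_mul hG.1 (mul_pos two_pos (h.rate_pos (by norm_num))),
      ⟨⟨by fun_prop, fun r hr s _ hrs => ?_, by simp⟩, ?_⟩, fun x hx t ht => ⟨?_, hdecay x hx t ht⟩⟩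
    · exact div_lt_div_of_pos_right (pow_lt_pow_left₀ hrs hr two_ne_zero) hC
    · exact (tendsto_pow_atTop two_ne_zero).atTop_div_const hC
    · rw [div_le_iff₀' hC]
      exact hCU _ (hx t ht).1
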